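/- There is an absolute constant $c>0$ such that the following holds. Let $H$ be a real or complex Hilbert space with scalar field $\mathbb K$, and let $K\subset H$ be nonempty, convex, bounded and centred (centrally symmetric if $\mathbb K=\mathbb R$; $\lambda K\subset K$ for all $|\lambda|\le 1$ if $\mathbb K=\mathbb C$). Let $X$ be the Banach space obtained by completing the linear span of $K$ in the norm $\|x\|_X=\inf\{\lambda>0 : x\in\lambda K\}$; the inclusion of the span of $K$ into $H$ extends continuously to $X$, and $\|x\|_H$, $\langle x,\cdot\rangle$, for $x\in X$, are understood via this extension $X\to H$. For $s>0$ put $K_s=\{x\in X : \|x\|_X\le\sqrt s\,\|x\|_H,\ \|x\|_H=1\}$. Let $m\ge1$, $d\ge 0$, and let $v_1,\dots,v_m$ be independent random bounded linear operators from $X$ to $\ell_2^d$. Here "random" means that each $v_j(x)$, $x\in X$, is a random vector and that either $X$ is separable or $v_j$ is a Bochner (strongly) measurable random element of the operator space $B(X,\ell_2^d)$, and "independent" means that the families $(v_j(x))_{x\in X}$, $j=1,\dots,m$, are independent. Let $\Phi:H\to H$ be a bounded linear operator with $\|\Phi\|\le 1$ and $$\mathbb E\,v_j^*v_j=\Phi,\quad\text{i.e.}\quad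 \mathbb E\langle v_j(x),v_j(y)\rangle=\langle x,\Phi y\rangle\quad\text{for all }x,y\in X,\ j=1,\dots,m.$$ Let $v=(v_j)_{1\le j\le m}:X\to\ell_\infty^m(\ell_2^d)$ be the composite map. For a bounded operator $T:E\to F$ between normed spaces with closed unit balls $B_E$, $B_F$ let $$e_l(T)=\inf\{\varepsilon>0 : T(B_E)\text{ is covered by at most }2^{l-1}\text{ translates of }\varepsilon B_F\},\qquad \mathcal E_{2,1}(T)=\sum_{l=1}^\infty\frac{e_l(T)}{\sqrt l}\in[0,\infty].$$ Let $\delta>0$ and $0<\zeta<1$. If $$\sup_{k\ge1}\ \frac{c\sqrt s}{\sqrt m}\,\max\Big(\big(\mathbb E\,\mathcal E_{2,1}(v)^{2k}\big)^{1/2k},\ \sqrt{\ln(\zeta^{-1})}\,\big(\mathbb E\|v\|^{2k}\big)^{1/2k}\Big)\le\delta,$$ the supremum being over integers $k\ge1$, then $$\mathbb P\Big(\sup_{x\in K_s}\Big|\frac1m\sum_{j=1}^m\|v_j(x)\|_2^2-\langle x,\Phi x\rangle\Big|\ge\max(\delta,\delta^2)\Big)\le\zeta .$$ -/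

import Mathlib

open MeasureTheory ProbabilityTheory Set
open scoped ENNReal NNReal Pointwise

set_option linter.unusedSectionVars false

noncomputable section

/-- A centred (balanced), bounded, convex subset `K` of a Hilbert space `H` over `𝕜 = ℝ` or `ℂ`.
For `𝕜 = ℝ` and nonempty convex `K`, balanced means the same as centrally symmetric. -/
structure CentredConvexBody (𝕜 : Type*) [RCLike 𝕜] (H : Type*) [NormedAddCommGroup H]
    [InnerProductSpace 𝕜 H] [NormedSpace ℝ H] where
  carrier : Set H
  nonempty' : carrier.Nonempty
  convex' : Convex ℝ carrier
  balanced' : Balanced 𝕜 carrier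
  bounded' : Bornology.IsBounded carrier

namespace CentredConvexBody

variable {𝕜 : Type*} [RCLike 𝕜] {H : Type*} [NormedAddCommGroup H]
  [InnerProductSpace 𝕜 H] [NormedSpace ℝ H] [IsScalarTower ℝ 𝕜 H] (K : CentredConvexBody 𝕜 H)

/-- The linear span of `K`; it will carry the Minkowski functional of `K` as its norm
(not the norm inherited from `H`). -/
def GaugeSpan : Type _ := ↥(Submodule.span 𝕜 K.carrier)

instance : AddCommGroup K.GaugeSpan :=
  inferInstanceAs (AddCommGroup ↥(Submodule.span 𝕜 K.carrier))

instance : Module 𝕜 K.GaugeSpan :=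
  inferInstanceAs (Module 𝕜 ↥(Submodule.span 𝕜 K.carrier))

/-- The inclusion of the span of `K` into `H`. -/
def incl : K.GaugeSpan →ₗ[𝕜] H := (Submodule.span 𝕜 K.carrier).subtype

/-- The Minkowski functional `p_K(x) = inf {r > 0 | x ∈ r K}` is the norm. -/
instance : Norm K.GaugeSpan := ⟨fun x => gauge K.carrier (K.incl x)⟩

theorem norm_def (x : K.GaugeSpan) : ‖x‖ = gauge K.carrier (K.incl x) := rfl

theorem zero_mem : (0 : H) ∈ K.carrier := by
  obtain ⟨x, hx⟩ := K.nonempty'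
  have h := K.balanced' 0 (by simp) (Set.smul_mem_smul_set hx)
  simpa using h

theorem coe_smul_eq (r : ℝ) (x : H) : ((r : 𝕜) • x : H) = r • x := by
  exact algebraMap_smul 𝕜 r x

theorem smul_mem_of_norm_le {x : H} (hx : x ∈ K.carrier) {a : 𝕜} (ha : ‖a‖ ≤ 1) :
    a • x ∈ K.carrier :=
  K.balanced' a ha (Set.smul_mem_smul_set hx)

theorem exists_smul_mem (x : K.GaugeSpan) :
    ∃ r : ℝ, 0 < r ∧ K.incl x ∈ r • K.carrier := by
  have key : ∀ y ∈ Submodule.span 𝕜 K.carrier, ∃ r : ℝ, 0 < r ∧ y ∈ r • K.carrier := by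
    intro y hy
    induction hy using Submodule.span_induction with
    | mem y hy => exact ⟨1, one_pos, by simpa using hy⟩
    | zero => exact ⟨1, one_pos, by simpa using K.zero_mem⟩
    | add y z _ _ hy hz =>
      obtain ⟨r, hr, hy⟩ := hy
      obtain ⟨t, ht, hz⟩ := hz
      refine ⟨r + t, by positivity, ?_⟩
      rw [K.convex'.add_smul hr.le ht.le]
      exact Set.add_mem_add hy hz
    | smul a y _ hy =>
      obtain ⟨r, hr, u, hu, rfl⟩ := hy
      have hn : 0 < ‖a‖ + 1 := by positivity
      refine ⟨(‖a‖ + 1) * r, by positivity, (((‖a‖ + 1 : ℝ) : 𝕜)⁻¹ * a) • u, ?_, ?_⟩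
      · apply K.smul_mem_of_norm_le hu
        rw [norm_mul, norm_inv, RCLike.norm_ofReal, abs_of_pos hn, inv_mul_le_one₀ hn]
        linarith
      · have h0 : ((‖a‖ + 1 : ℝ) : 𝕜) ≠ 0 := by exact_mod_cast hn.ne'
        simp only
        rw [← coe_smul_eq (𝕜 := 𝕜) ((‖a‖ + 1) * r), ← coe_smul_eq (𝕜 := 𝕜) r, smul_smul,
          smul_smul]
        congr 1
        rw [RCLike.ofReal_mul, mul_assoc, ← mul_assoc (r : 𝕜), mul_comm (r : 𝕜), mul_assoc,
          ← mul_assoc, mul_inv_cancel₀ h0, one_mul, mul_comm]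
  exact key _ x.2

theorem exists_norm_incl_le : ∃ R : ℝ, 0 < R ∧ ∀ x : K.GaugeSpan, ‖K.incl x‖ ≤ R * ‖x‖ := by
  obtain ⟨R, hR, hK⟩ := K.bounded'.exists_pos_norm_le
  refine ⟨R, hR, fun x => ?_⟩
  have hne : {r ∈ Set.Ioi (0 : ℝ) | K.incl x ∈ r • K.carrier}.Nonempty := by
    obtain ⟨r, hr, h⟩ := K.exists_smul_mem x
    exact ⟨r, hr, h⟩
  rw [mul_comm, ← div_le_iff₀ hR, norm_def, gauge_def]
  refine le_csInf hne ?_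
  rintro r ⟨hr, u, hu, hx⟩
  have hr' : (0 : ℝ) < r := hr
  rw [div_le_iff₀ hR, ← hx]
  simp only [norm_smul, Real.norm_eq_abs, abs_of_pos hr']
  exact mul_le_mul_of_nonneg_left (hK u hu) hr'.le

theorem gaugeCore : NormedSpace.Core 𝕜 K.GaugeSpan where
  norm_nonneg x := gauge_nonneg _
  norm_smul a x := by
    rw [norm_def, norm_def, map_smul, gauge_smul K.balanced']
  norm_triangle x y := by
    refine le_of_forall_pos_lt_add fun ε hε => ?_
    have ne : ∀ z : K.GaugeSpan, {r ∈ Set.Ioi (0 : ℝ) | K.incl z ∈ r • K.carrier}.Nonempty := by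
      intro z
      obtain ⟨r, hr, h⟩ := K.exists_smul_mem z
      exact ⟨r, hr, h⟩
    have hx : gauge K.carrier (K.incl x) < ‖x‖ + ε / 2 := by rw [norm_def]; linarith
    have hy : gauge K.carrier (K.incl y) < ‖y‖ + ε / 2 := by rw [norm_def]; linarith
    rw [gauge_def] at hx hy
    obtain ⟨r, ⟨hr, hxr⟩, hr2⟩ := exists_lt_of_csInf_lt (ne x) hx
    obtain ⟨t, ⟨ht, hyt⟩, ht2⟩ := exists_lt_of_csInf_lt (ne y) hy
    have hr' : (0 : ℝ) < r := hr
    have ht' : (0 : ℝ) < t := ht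
    have hmem : K.incl (x + y) ∈ (r + t) • K.carrier := by
      rw [K.convex'.add_smul hr'.le ht'.le, map_add]
      exact Set.add_mem_add hxr hyt
    have := gauge_le_of_mem (by positivity) hmem
    rw [norm_def]
    linarith
  norm_eq_zero_iff x := by
    constructor
    · intro h
      obtain ⟨R, _, hR⟩ := K.exists_norm_incl_le
      have h1 := hR x
      rw [h, mul_zero] at h1
      have h2 : K.incl x = 0 := norm_le_zero_iff.1 h1
      exact Subtype.ext h2
    · rintro rfl
      rw [norm_def, map_zero, gauge_zero]

instance : NormedAddCommGroup K.GaugeSpan := NormedAddCommGroup.ofCore K.gaugeCore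

instance : NormedSpace 𝕜 K.GaugeSpan := NormedSpace.ofCore K.gaugeCore

/-- The Banach space `X` induced by `K`: the completion of the span of `K` with respect to the
Minkowski functional of `K`. -/
abbrev X : Type _ := UniformSpace.Completion K.GaugeSpan

/-- The inclusion of the span of `K` into `H`, as a bounded operator. -/
def inclL : K.GaugeSpan →L[𝕜] H :=
  LinearMap.mkContinuousOfExistsBound K.incl
    (by obtain ⟨R, _, hR⟩ := K.exists_norm_incl_le; exact ⟨R, hR⟩)

/-- The canonical map `X → H`: the continuous extension of the inclusion of the span of `K`. -/
def toH [CompleteSpace H] : K.X →L[𝕜] H :=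
  K.inclL.extend (UniformSpace.Completion.toComplL : K.GaugeSpan →L[𝕜] K.X)

theorem toH_coe [CompleteSpace H] (x : K.GaugeSpan) : K.toH (x : K.X) = K.incl x :=
  ContinuousLinearMap.extend_eq (f := K.inclL)
    (e := (UniformSpace.Completion.toComplL : K.GaugeSpan →L[𝕜] K.X))
    UniformSpace.Completion.denseRange_coe
    (UniformSpace.Completion.isUniformInducing_coe _) x

/-- The set `K_s` of `(K, s)`-sparse vectors, `‖x‖_X ≤ √s ‖x‖_H`, of unit norm `‖x‖_H = 1`. -/
def sparseSphere [CompleteSpace H] (s : ℝ) : Set K.X :=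
  {x | ‖x‖ ≤ Real.sqrt s * ‖K.toH x‖ ∧ ‖K.toH x‖ = 1}

end CentredConvexBody

section Entropy

variable {𝕜 E F : Type*} [RCLike 𝕜] [NormedAddCommGroup E] [NormedSpace 𝕜 E]
  [NormedAddCommGroup F] [NormedSpace 𝕜 F]

/-- The dyadic entropy number `e_l(T) = inf {ε > 0 | N(T(B_E), ε B_F) ≤ 2 ^ (l - 1)}`, `l ≥ 1`,
where `N(A, ε B_F)` is the least number of translates of `ε B_F` that cover `A`. -/
def entropyNumber (T : E →L[𝕜] F) (l : ℕ) : ℝ≥0∞ :=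
  ⨅ (ε : ℝ≥0) (_ : 0 < ε)
    (_ : Metric.externalCoveringNumber ε (T '' Metric.closedBall 0 1) ≤ 2 ^ (l - 1)), (ε : ℝ≥0∞)

/-- `𝓔_{2,1}(T) = ∑_{l ≥ 1} e_l(T) / √l`, the `ℓ(2,1)` norm of the dyadic entropy numbers. -/
def entropySum (T : E →L[𝕜] F) : ℝ≥0∞ :=
  ∑' l : ℕ, entropyNumber T (l + 1) / ENNReal.ofReal (Real.sqrt ((l : ℝ) + 1))

end Entropy

/-- A random bounded operator `E → F`: all `ω ↦ v ω x` are random vectors and, so that suprema over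
subsets of `E` make sense as random variables, `E` is separable or `v` is a random element of the
normed space of operators in the sense of Bochner. -/
def IsRandomOperator {𝕜 E F Ω : Type*} [RCLike 𝕜] [NormedAddCommGroup E] [NormedSpace 𝕜 E]
    [NormedAddCommGroup F] [NormedSpace 𝕜 F] [MeasurableSpace F] [MeasurableSpace Ω]
    (v : Ω → E →L[𝕜] F) (P : Measure Ω) : Prop :=
  (∀ x : E, Measurable fun ω => v ω x) ∧
    (TopologicalSpace.SeparableSpace E ∨ AEStronglyMeasurable v P)

/-- The moment `(𝔼 f ^ (2k)) ^ (1 / (2k))` of a nonnegative random variable, `k ≥ 1`. -/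
def evenMoment {Ω : Type*} [MeasurableSpace Ω] (P : Measure Ω) (f : Ω → ℝ≥0∞) (k : ℕ) : ℝ≥0∞ :=
  (∫⁻ ω, f ω ^ (2 * k) ∂P) ^ (1 / (2 * (k : ℝ)))

/-- `𝔼 v* v = Φ` for a random operator `v : X → F`, where `X` is the Banach space induced by `K`
and `Φ : H → H`; that is, `𝔼 ⟨v x, v y⟩ = ⟨x, Φ y⟩_H` for all `x, y` in `X`. -/
def HasSecondMoment {𝕜 H F Ω : Type*} [RCLike 𝕜] [NormedAddCommGroup H] [InnerProductSpace 𝕜 H]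
    [NormedSpace ℝ H] [IsScalarTower ℝ 𝕜 H] [CompleteSpace H]
    [NormedAddCommGroup F] [InnerProductSpace 𝕜 F]
    [MeasurableSpace Ω] (K : CentredConvexBody 𝕜 H) (v : Ω → K.X →L[𝕜] F) (P : Measure Ω)
    (Φ : H →L[𝕜] H) : Prop :=
  ∀ x y : K.X, Integrable (fun ω => inner 𝕜 (v ω x) (v ω y)) P ∧
    ∫ ω, inner 𝕜 (v ω x) (v ω y) ∂P = inner 𝕜 (K.toH x) (Φ (K.toH y))

end

/-! Fix finitely many points `x` of `K_s` and let Z be the vector of deviations (1/m) ∑ ‖v_j x‖² -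
⟨x, Φx⟩. Symmetrization bounds the k-th moment of m‖Z‖_∞ by that of the Rademacher process ∑ ±‖v_j
x‖², with `v` held fixed. Factoring differences of squares shows that the increments of this process
are subgaussian for the distance 2ρ‖v(x) - v(y)‖_∞, where ρ² bounds every ∑ ‖v_j x‖². The points lie
in √s times the unit ball of `X`, so the entropy numbers of `v` supply the nets, and chaining gives
a bound of order ρ√s(𝓔_{2,1}(v) + √k‖v‖) for the L^k norm (`chaining_signs`,
`rademacher_norm_sq_moment_le`, `rademacher_operator_moment_le`).

The radius ρ is random, but ⟨x, Φx⟩ ≤ 1 gives ρ² ≤ m(1 + ‖Z‖_∞). Cauchy–Schwarz then yields a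
self-bounding inequality z ≤ A√(1 + z) for the L^k norm z of ‖Z‖_∞ (`deviation_moment_le`), hence z
≤ A + A² (`le_add_sq_of_le_mul_sqrt`). For k = ⌈ln ζ⁻¹⌉ the hypothesis forces A ≤ δ/8, up to an
arbitrarily small slack built into A, and Markov's inequality settles finite sets
(`measure_deviation_finite_le`).

Finally, separability of `X` or of the range of `v` yields a countable subset of `K_s` that decides
almost surely whether the supremum exceeds a level, and continuity from below passes from finite to
countable sets. The constants are not optimized. -/

/-! ### Moments of Rademacher sums and chaining over finite families. -/

/-- The sign `±1` encoded by a Boolean. -/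
def boolSign (b : Bool) : ℝ := if b then 1 else -1

theorem sum_exp_signs_le {m : ℕ} (a : Fin m → ℝ) :
    ∑ σ : Fin m → Bool, Real.exp (∑ j, boolSign (σ j) * a j) ≤
      2 ^ m * Real.exp ((∑ j, a j ^ 2) / 2) := by
  have h1 : ∑ σ : Fin m → Bool, Real.exp (∑ j, boolSign (σ j) * a j) =
      ∏ j, (2 * Real.cosh (a j)) := by
    simp_rw [Real.exp_sum]
    rw [← Fintype.prod_sum (fun j (b : Bool) => Real.exp (boolSign b * a j))]
    refine Finset.prod_congr rfl fun j _ => ?_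
    rw [Fintype.sum_bool, Real.cosh_eq]
    simp only [boolSign, if_true, Bool.false_eq_true, if_false]
    ring_nf
  rw [h1, Finset.prod_mul_distrib, Finset.sum_div, Real.exp_sum]
  simp only [Finset.prod_const, Finset.card_univ, Fintype.card_fin]
  gcongr
  exact Real.cosh_le_exp_half_sq _

/-- Khintchine's inequality with the right growth √q of the moment constants: a power is dominated
by an exponential, and the exponential moments of the sum are subgaussian. -/
theorem sum_signs_even_moment_le {m : ℕ} (a : Fin m → ℝ) {r : ℝ} (hr : 0 < r)
    (ha : ∑ j, a j ^ 2 ≤ r ^ 2) {q : ℕ} (hq : 0 < q) :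
    ∑ σ : Fin m → Bool, (|∑ j, boolSign (σ j) * a j| / r) ^ (2 * q) ≤
      2 ^ m * (4 * Real.exp 1 * q) ^ q := by
  have hq' : (0 : ℝ) < q := by exact_mod_cast hq
  -- This value minimizes exp(t²/2) / t^(2q), the loss in passing from exponential to power moments.
  set t : ℝ := Real.sqrt (2 * q) with ht
  have ht2 : t ^ 2 = 2 * q := Real.sq_sqrt (by positivity)
  have ht0 : 0 < t := Real.sqrt_pos.2 (by positivity)
  have key : ∀ c : ℝ, c ^ 2 = t ^ 2 / r ^ 2 →
      ∑ σ : Fin m → Bool, Real.exp (c * ∑ j, boolSign (σ j) * a j) ≤ 2 ^ m * Real.exp q := by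
    intro c hc
    have h := sum_exp_signs_le (fun j => c * a j)
    simp only [mul_left_comm _ c, ← Finset.mul_sum, mul_pow] at h
    refine h.trans ?_
    gcongr
    rw [hc, ht2, div_mul_eq_mul_div, div_div, div_le_iff₀ (by positivity)]
    nlinarith
  have hfac : ((2 * q).factorial : ℝ) ≤ (2 * q : ℝ) ^ (2 * q) := by
    exact_mod_cast Nat.factorial_le_pow (2 * q)
  have pt : ∀ X : ℝ, (|X| / r) ^ (2 * q) ≤
      (2 * q : ℝ) ^ q * (Real.exp (t / r * X) + Real.exp (-(t / r) * X)) := by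
    intro X
    have h := Real.pow_div_factorial_le_exp (x := t * (|X| / r)) (by positivity) (2 * q)
    rw [div_le_iff₀ (by positivity), mul_pow, pow_mul t, ht2] at h
    have hexp : Real.exp (t * (|X| / r)) ≤ Real.exp (t / r * X) + Real.exp (-(t / r) * X) := by
      rcases abs_cases X with ⟨h, _⟩ | ⟨h, _⟩ <;> rw [h]
      · rw [show t * (X / r) = t / r * X by ring]
        linarith [Real.exp_pos (-(t / r) * X)]
      · rw [show t * (-X / r) = -(t / r) * X by ring]
        linarith [Real.exp_pos (t / r * X)]
    have h3 : (2 * q : ℝ) ^ q * (|X| / r) ^ (2 * q) ≤ (2 * q : ℝ) ^ q * ((2 * q : ℝ) ^ q *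
        (Real.exp (t / r * X) + Real.exp (-(t / r) * X))) := by
      calc _ ≤ _ := h
        _ ≤ (Real.exp (t / r * X) + Real.exp (-(t / r) * X)) * (2 * q : ℝ) ^ (2 * q) := by gcongr
        _ = _ := by rw [two_mul q, pow_add]; ring
    exact le_of_mul_le_mul_left h3 (by positivity)
  calc ∑ σ : Fin m → Bool, (|∑ j, boolSign (σ j) * a j| / r) ^ (2 * q)
      ≤ ∑ σ : Fin m → Bool, (2 * q : ℝ) ^ q * (Real.exp (t / r * ∑ j, boolSign (σ j) * a j) +
          Real.exp (-(t / r) * ∑ j, boolSign (σ j) * a j)) :=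
        Finset.sum_le_sum fun σ _ => pt _
    _ ≤ (2 * q : ℝ) ^ q * (2 ^ m * Real.exp q + 2 ^ m * Real.exp q) := by
        rw [← Finset.mul_sum, Finset.sum_add_distrib]
        gcongr
        · exact key _ (by rw [div_pow])
        · exact key _ (by rw [neg_sq, div_pow])
    _ = 2 ^ m * (2 * (2 * Real.exp 1 * q) ^ q) := by
        rw [mul_pow, mul_pow, mul_pow, ← Real.exp_nat_mul, mul_one]; ring
    _ ≤ 2 ^ m * (4 * Real.exp 1 * q) ^ q := by
        gcongr
        rw [show 4 * Real.exp 1 * q = 2 * (2 * Real.exp 1 * q) by ring, mul_pow 2]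
        gcongr
        exact le_self_pow₀ (by norm_num) hq.ne'

theorem sum_half_pow_two_pow_le (N l₀ : ℕ) :
    ∑ l ∈ Finset.range N, (1 / 2 : ℝ) ^ (2 ^ (l₀ + l)) ≤ 1 := by
  have h : ∀ l, (1 / 2 : ℝ) ^ (2 ^ (l₀ + l)) ≤ (1 / 2 : ℝ) ^ (l + 1) := fun l =>
    pow_le_pow_of_le_one (by norm_num) (by norm_num)
      ((Nat.lt_two_pow_self (n := l)).trans_le (Nat.pow_le_pow_right (by norm_num) (by omega)))
  have h2 : ∀ N, ∑ l ∈ Finset.range N, (1 / 2 : ℝ) ^ (l + 1) = 1 - (1 / 2) ^ N := by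
    intro N
    induction N with
    | zero => simp
    | succ n ih => rw [Finset.sum_range_succ, ih]; ring
  calc _ ≤ ∑ l ∈ Finset.range N, (1 / 2 : ℝ) ^ (l + 1) := Finset.sum_le_sum fun l _ => h l
    _ ≤ 1 := by rw [h2]; linarith [show (0 : ℝ) ≤ (1 / 2) ^ N by positivity]

/-- Generic chaining bound for the `p`-th moment of the supremum of a finite Rademacher process
whose coefficients are sums of links `Y l i`, with at most `2 ^ (2 q)` links of length at most `r l`
on the level `l`, where `q = 2 ^ (l₀ + l)`. -/
theorem chaining_signs {ι : Type*} [Fintype ι] {m : ℕ} (N l₀ p : ℕ) (hp : 0 < p)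
    (hpl : p ≤ 2 ^ l₀) (Y : ℕ → ι → Fin m → ℝ) (r : ℕ → ℝ) (hr : ∀ l, 0 < r l)
    (hY : ∀ l i, ∑ j, Y l i j ^ 2 ≤ r l ^ 2)
    (hcard : ∀ l, (Set.range (Y l)).ncard ≤ 2 ^ (2 * 2 ^ (l₀ + l))) :
    ∑ σ : Fin m → Bool,
        ‖fun i => ∑ j, boolSign (σ j) * ∑ l ∈ Finset.range N, Y l i j‖ ^ p ≤
      2 ^ m * (20 * ∑ l ∈ Finset.range N, r l * Real.sqrt (2 ^ (l₀ + l))) ^ p := by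
  classical
  set q : ℕ → ℕ := fun l => 2 ^ (l₀ + l) with hq
  have hq0 : ∀ l, 0 < q l := fun l => by positivity
  -- The factor 10 lets the moments beat the number of links: 2² · 4e / 100 < 1/2, so level `l`
  -- contributes at most (1/2)^(q l) on average to `S` below.
  set u : ℕ → ℝ := fun l => 10 * Real.sqrt (2 ^ (l₀ + l)) with hu
  have hu0 : ∀ l, 0 < u l := fun l => by positivity
  have hu2 : ∀ l, u l ^ 2 = 100 * q l := by
    intro l
    rw [hu, mul_pow, Real.sq_sqrt (by positivity), hq]
    push_cast
    norm_num
  set A : ℕ → Finset (Fin m → ℝ) := fun l => Finset.univ.image (Y l) with hA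
  have hAcard : ∀ l, ((A l).card : ℝ) ≤ 2 ^ (2 * q l) := by
    intro l
    have := hcard l
    rw [← Set.image_univ, ← Finset.coe_univ, ← Finset.coe_image, Set.ncard_coe_finset] at this
    exact_mod_cast this
  set Xf : (Fin m → Bool) → (Fin m → ℝ) → ℝ := fun σ y => |∑ j, boolSign (σ j) * y j| with hX
  set S : (Fin m → Bool) → ℝ := fun σ =>
    ∑ l ∈ Finset.range N, ∑ y ∈ A l, (Xf σ y / (r l * u l)) ^ (2 * q l) with hS
  have hterm : ∀ σ l y, 0 ≤ (Xf σ y / (r l * u l)) ^ (2 * q l) :=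
    fun σ l y => (even_two_mul _).pow_nonneg _
  have hS0 : ∀ σ, 0 ≤ S σ := fun σ =>
    Finset.sum_nonneg fun l _ => Finset.sum_nonneg fun y _ => hterm σ l y
  set D : ℝ := ∑ l ∈ Finset.range N, r l * u l with hD
  have hD0 : 0 ≤ D := Finset.sum_nonneg fun l _ => (mul_pos (hr l) (hu0 l)).le
  have hpt : ∀ σ : Fin m → Bool,
      ‖fun i => ∑ j, boolSign (σ j) * ∑ l ∈ Finset.range N, Y l i j‖ ^ p ≤
        D ^ p * (1 + S σ) := by
    intro σ
    -- One random factor `Q` controls all links at once. A normalized link `z > 1` has `z ^ p ≤ z ^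
    -- (2 * q l) ≤ S σ`, because `p ≤ 2 ^ l₀ ≤ 2 * q l`; this is why chaining starts at level `l₀`.
    set Q : ℝ := (1 + S σ) ^ ((p : ℝ)⁻¹) with hQ
    have hQ0 : 0 ≤ Q := Real.rpow_nonneg (by linarith [hS0 σ]) _
    have hQp : Q ^ p = 1 + S σ := Real.rpow_inv_natCast_pow (by linarith [hS0 σ]) hp.ne'
    have hlink : ∀ l ∈ Finset.range N, ∀ i, Xf σ (Y l i) ≤ r l * u l * Q := by
      intro l hl i
      have hru : 0 < r l * u l := mul_pos (hr l) (hu0 l)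
      rw [mul_comm, ← div_le_iff₀ hru]
      set z := Xf σ (Y l i) / (r l * u l) with hz
      have hz0 : 0 ≤ z := div_nonneg (abs_nonneg _) hru.le
      refine le_of_pow_le_pow_left₀ hp.ne' hQ0 ?_
      rw [hQp]
      have h1 : z ^ (2 * q l) ≤ S σ := by
        refine le_trans ?_ (Finset.single_le_sum
          (f := fun l => ∑ y ∈ A l, (Xf σ y / (r l * u l)) ^ (2 * q l))
          (fun l _ => Finset.sum_nonneg fun y _ => hterm σ l y) hl)
        exact Finset.single_le_sum (f := fun y => (Xf σ y / (r l * u l)) ^ (2 * q l))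
          (fun y _ => hterm σ l y) (Finset.mem_image_of_mem _ (Finset.mem_univ i))
      rcases le_total z 1 with h | h
      · linarith [pow_le_one₀ (n := p) hz0 h, hS0 σ]
      · have hpq : p ≤ 2 * q l := by
          have : 2 ^ l₀ ≤ 2 ^ (l₀ + l) := Nat.pow_le_pow_right (by norm_num) (by omega)
          simp only [hq]; omega
        linarith [pow_le_pow_right₀ h hpq]
    rw [← hQp, ← mul_pow]
    gcongr
    rw [pi_norm_le_iff_of_nonneg (by positivity)]
    intro i
    have hcomm : ∑ j, boolSign (σ j) * ∑ l ∈ Finset.range N, Y l i j =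
        ∑ l ∈ Finset.range N, ∑ j, boolSign (σ j) * Y l i j := by
      simp_rw [Finset.mul_sum]
      exact Finset.sum_comm
    rw [hcomm, Real.norm_eq_abs, hD, Finset.sum_mul]
    exact (Finset.abs_sum_le_sum_abs _ _).trans (Finset.sum_le_sum fun l hl => hlink l hl i)
  have hlev : ∀ l, ∑ σ : Fin m → Bool, ∑ y ∈ A l, (Xf σ y / (r l * u l)) ^ (2 * q l) ≤
      2 ^ m * (1 / 2 : ℝ) ^ (q l) := by
    intro l
    rw [Finset.sum_comm]
    have h1 : ∀ y ∈ A l, ∑ σ : Fin m → Bool, (Xf σ y / (r l * u l)) ^ (2 * q l) ≤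
        2 ^ m * (4 * Real.exp 1 * q l) ^ q l / (100 * q l) ^ q l := by
      intro y hy
      obtain ⟨i, -, rfl⟩ := Finset.mem_image.1 hy
      have := sum_signs_even_moment_le (Y l i) (hr l) (hY l i) (hq0 l)
      simp_rw [← div_div, div_pow _ (u l), pow_mul (u l), hu2, ← Finset.sum_div]
      gcongr
    refine (Finset.sum_le_sum h1).trans ?_
    rw [Finset.sum_const, nsmul_eq_mul]
    have hq' : (0 : ℝ) < q l := by exact_mod_cast hq0 l
    calc ((A l).card : ℝ) * (2 ^ m * (4 * Real.exp 1 * q l) ^ q l / (100 * q l) ^ q l)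
        ≤ 2 ^ (2 * q l) * (2 ^ m * (4 * Real.exp 1 * q l) ^ q l / (100 * q l) ^ q l) := by
          gcongr
          exact hAcard l
      _ = 2 ^ m * (2 ^ 2 * (4 * Real.exp 1 * q l) / (100 * q l)) ^ q l := by
          rw [div_pow, mul_pow (2 ^ 2 : ℝ), ← pow_mul (2 : ℝ) 2 (q l)]; ring
      _ ≤ 2 ^ m * (1 / 2 : ℝ) ^ (q l) := by
          refine mul_le_mul_of_nonneg_left (pow_le_pow_left₀ (by positivity) ?_ _) (by positivity)
          rw [div_le_iff₀ (by positivity)]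
          nlinarith [Real.exp_one_lt_d9]
  calc ∑ σ : Fin m → Bool,
        ‖fun i => ∑ j, boolSign (σ j) * ∑ l ∈ Finset.range N, Y l i j‖ ^ p
      ≤ ∑ σ : Fin m → Bool, D ^ p * (1 + S σ) := Finset.sum_le_sum fun σ _ => hpt σ
    _ = D ^ p * (2 ^ m + ∑ l ∈ Finset.range N, ∑ σ : Fin m → Bool,
          ∑ y ∈ A l, (Xf σ y / (r l * u l)) ^ (2 * q l)) := by
        rw [← Finset.mul_sum, Finset.sum_add_distrib, Finset.sum_comm]
        simp
    _ ≤ D ^ p * (2 ^ m + 2 ^ m * 1) := by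
        gcongr
        refine (Finset.sum_le_sum fun l _ => hlev l).trans ?_
        rw [← Finset.mul_sum]
        gcongr
        exact sum_half_pow_two_pow_le N l₀
    _ = 2 ^ m * (2 * D ^ p) := by ring
    _ ≤ 2 ^ m * (2 * D) ^ p := by
        gcongr
        rw [mul_pow]
        gcongr
        exact le_self_pow₀ (by norm_num) hp.ne'
    _ = _ := by
        rw [hD, hu, Finset.mul_sum, Finset.mul_sum]
        congr 2
        exact Finset.sum_congr rfl fun l _ => by ring

theorem exists_two_pow_between {p : ℕ} (hp : 0 < p) : ∃ l, p ≤ 2 ^ l ∧ 2 ^ l ≤ 2 * p := by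
  have h : ∃ l, p ≤ 2 ^ l := ⟨p, Nat.lt_two_pow_self.le⟩
  classical
  refine ⟨Nat.find h, Nat.find_spec h, ?_⟩
  rcases hl : Nat.find h with _ | k
  · omega
  · have := Nat.find_min h (m := k) (by omega)
    rw [pow_succ]
    omega

/-- In a² - b² = (a - b)(a + b) the sup-norm distance controls the first factor for each `j`, while
the sums of squares control the second after summation over `j`. This makes the sup norm the metric
for chaining. -/
theorem sum_sq_norm_sq_sub_le {F : Type*} [NormedAddCommGroup F] {m : ℕ} (x y : Fin m → F)
    {ρ D : ℝ} (hx : ∑ j, ‖x j‖ ^ 2 ≤ ρ ^ 2) (hy : ∑ j, ‖y j‖ ^ 2 ≤ ρ ^ 2)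
    (hxy : ‖x - y‖ ≤ D) : ∑ j, (‖x j‖ ^ 2 - ‖y j‖ ^ 2) ^ 2 ≤ (2 * ρ * D) ^ 2 := by
  have h : ∀ j, (‖x j‖ ^ 2 - ‖y j‖ ^ 2) ^ 2 ≤ D ^ 2 * (2 * (‖x j‖ ^ 2 + ‖y j‖ ^ 2)) := by
    intro j
    have h1 : (‖x j‖ - ‖y j‖) ^ 2 ≤ D ^ 2 := by
      rw [← sq_abs]
      gcongr
      exact (abs_norm_sub_norm_le _ _).trans ((norm_le_pi_norm (x - y) j).trans hxy)
    calc (‖x j‖ ^ 2 - ‖y j‖ ^ 2) ^ 2 = (‖x j‖ - ‖y j‖) ^ 2 * (‖x j‖ + ‖y j‖) ^ 2 := by ring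
      _ ≤ D ^ 2 * (2 * (‖x j‖ ^ 2 + ‖y j‖ ^ 2)) := by
        gcongr
        nlinarith [sq_nonneg (‖x j‖ - ‖y j‖)]
  refine (Finset.sum_le_sum fun j _ => h j).trans ?_
  rw [← Finset.mul_sum, ← Finset.mul_sum, Finset.sum_add_distrib]
  nlinarith [sq_nonneg D]

theorem sum_norm_pow_four_le {F : Type*} [NormedAddCommGroup F] {m : ℕ} (x : Fin m → F)
    {ρ V : ℝ} (hx : ∑ j, ‖x j‖ ^ 2 ≤ ρ ^ 2) (hxV : ‖x‖ ≤ V) :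
    ∑ j, (‖x j‖ ^ 2) ^ 2 ≤ (ρ * V) ^ 2 := by
  have h : ∀ j, (‖x j‖ ^ 2) ^ 2 ≤ V ^ 2 * ‖x j‖ ^ 2 := by
    intro j
    rw [sq (‖x j‖ ^ 2)]
    gcongr
    exact (norm_le_pi_norm x j).trans hxV
  refine (Finset.sum_le_sum fun j _ => h j).trans ?_
  rw [← Finset.mul_sum]
  nlinarith [sq_nonneg V]

/-- Dudley-type moment bound for the Rademacher process `∑ j, ± ‖b i j‖ ^ 2` in terms of nets of
the finite family `b` for the sup norm. -/
theorem rademacher_norm_sq_moment_le {ι F : Type*} [Fintype ι] [NormedAddCommGroup F] {m : ℕ}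
    (b : ι → Fin m → F) {ρ V : ℝ} (hρ : 0 < ρ) (hV : 0 < V)
    (hbρ : ∀ i, ∑ j, ‖b i j‖ ^ 2 ≤ ρ ^ 2) (hbV : ∀ i, ‖b i‖ ≤ V)
    (ε : ℕ → ℝ) (hε : ∀ n, 0 < ε n)
    (hnet : ∀ n, ∃ π : ι → ι, (Set.range π).ncard ≤ 2 ^ 2 ^ n ∧
      ∀ i, ‖b i - b (π i)‖ ≤ 2 * ε n) {p : ℕ} (hp : 0 < p) :
    ∃ N, ∑ σ : Fin m → Bool, ‖fun i => ∑ j, boolSign (σ j) * ‖b i j‖ ^ 2‖ ^ p ≤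
      2 ^ m * (240 * ρ * (Real.sqrt p * V + ∑ n ∈ Finset.range N, Real.sqrt (2 ^ n) * ε n)) ^ p := by
  classical
  obtain ⟨l₀, hl₀, hl₀'⟩ := exists_two_pow_between hp
  choose π₀ hπ₀ hπ₀' using hnet
  obtain ⟨L, hL⟩ : ∃ L, Fintype.card ι ≤ 2 ^ 2 ^ L :=
    ⟨Fintype.card ι, Nat.lt_two_pow_self.le.trans
      (Nat.pow_le_pow_right (by norm_num) Nat.lt_two_pow_self.le)⟩
  -- From level `L` on, all of `ι` is an admissible net, so the chain ends exactly at the given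
  -- points and leaves no remainder.
  set π : ℕ → ι → ι := fun n => if n < L then π₀ n else id with hπdef
  have hπ : ∀ n, (Set.range (π n)).ncard ≤ 2 ^ 2 ^ n := by
    intro n
    simp only [hπdef]
    split_ifs with h
    · exact hπ₀ n
    · rw [Set.range_id, Set.ncard_univ, Nat.card_eq_fintype_card]
      exact hL.trans (Nat.pow_le_pow_right (by norm_num)
        (Nat.pow_le_pow_right (by norm_num) (by omega)))
  have hπ' : ∀ n i, ‖b i - b (π n i)‖ ≤ 2 * ε n := by
    intro n i
    simp only [hπdef]
    split_ifs with h
    · exact hπ₀' n i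
    · simpa using (hε n).le
  set a : ι → Fin m → ℝ := fun i j => ‖b i j‖ ^ 2 with ha
  set Y : ℕ → ι → Fin m → ℝ := fun l i => Nat.casesOn l (a (π l₀ i))
    (fun k => a (π (l₀ + (k + 1)) i) - a (π (l₀ + k) i)) with hYdef
  set r : ℕ → ℝ := fun l => Nat.casesOn l (ρ * V)
    (fun k => 2 * ρ * (2 * ε (l₀ + k) + 2 * ε (l₀ + (k + 1)))) with hrdef
  have htel : ∀ N i j, ∑ l ∈ Finset.range (N + 1), Y l i j = a (π (l₀ + N) i) j := by
    intro N i j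
    induction N with
    | zero => simp [hYdef]
    | succ n ih => rw [Finset.sum_range_succ, ih]; simp [hYdef]
  have hr : ∀ l, 0 < r l := by
    rintro (_ | k)
    · exact mul_pos hρ hV
    · have := hε (l₀ + k)
      have := hε (l₀ + (k + 1))
      simp only [hrdef]
      positivity
  have hY : ∀ l i, ∑ j, Y l i j ^ 2 ≤ r l ^ 2 := by
    rintro (_ | k) i
    · exact sum_norm_pow_four_le _ (hbρ _) (hbV _)
    · refine sum_sq_norm_sq_sub_le _ _ (hbρ _) (hbρ _) ?_
      · have h1 := hπ' (l₀ + k) i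
        have h2 := hπ' (l₀ + (k + 1)) i
        rw [norm_sub_rev] at h2
        have h3 := norm_add_le (b (π (l₀ + (k + 1)) i) - b i) (b i - b (π (l₀ + k) i))
        rw [sub_add_sub_cancel] at h3
        linarith
  -- A link is determined by its two endpoints; the product of two consecutive net sizes explains
  -- the factor 2 in the exponent.
  have hcard : ∀ l, (Set.range (Y l)).ncard ≤ 2 ^ (2 * 2 ^ (l₀ + l)) := by
    rintro (_ | k)
    · have hsub : Set.range (Y 0) ⊆ a '' Set.range (π l₀) := by
        rintro _ ⟨i, rfl⟩
        exact ⟨_, ⟨i, rfl⟩, rfl⟩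
      calc _ ≤ _ := Set.ncard_le_ncard hsub (Set.toFinite _)
        _ ≤ _ := Set.ncard_image_le (Set.toFinite _)
        _ ≤ _ := hπ l₀
        _ ≤ _ := Nat.pow_le_pow_right (by norm_num) (by rw [add_zero]; omega)
    · have hsub : Set.range (Y (k + 1)) ⊆ (fun x : ι × ι => a x.1 - a x.2) ''
          (Set.range (π (l₀ + (k + 1))) ×ˢ Set.range (π (l₀ + k))) := by
        rintro _ ⟨i, rfl⟩
        exact ⟨(_, _), ⟨⟨i, rfl⟩, ⟨i, rfl⟩⟩, rfl⟩
      calc _ ≤ _ := Set.ncard_le_ncard hsub (Set.toFinite _)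
        _ ≤ _ := Set.ncard_image_le (Set.toFinite _)
        _ ≤ 2 ^ 2 ^ (l₀ + (k + 1)) * 2 ^ 2 ^ (l₀ + k) := by
          rw [Set.ncard_prod]
          exact Nat.mul_le_mul (hπ _) (hπ _)
        _ ≤ _ := by
          rw [← pow_add]
          refine Nat.pow_le_pow_right (by norm_num) ?_
          rw [two_mul]
          gcongr <;> omega
  have hfin := chaining_signs (L + 1) l₀ p hp hl₀ Y r hr hY hcard
  have hend : ∀ i, π (l₀ + L) i = i := by
    intro i
    simp [hπdef]
  simp only [htel, hend] at hfin
  refine ⟨l₀ + L + 1, hfin.trans ?_⟩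
  have hrs : ∀ l, 0 ≤ r l * Real.sqrt (2 ^ (l₀ + l)) := fun l =>
    mul_nonneg (hr l).le (Real.sqrt_nonneg _)
  refine mul_le_mul_of_nonneg_left (pow_le_pow_left₀
    (mul_nonneg (by norm_num) (Finset.sum_nonneg fun l _ => hrs l)) ?_ _) (by positivity)
  set f : ℕ → ℝ := fun n => Real.sqrt (2 ^ n) * ε n with hf
  have hf0 : ∀ n, 0 ≤ f n := fun n => mul_nonneg (Real.sqrt_nonneg _) (hε n).le
  set Tf := ∑ n ∈ Finset.range (l₀ + L + 1), f n with hTf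
  have hs1 : ∑ k ∈ Finset.range L, f (l₀ + k) ≤ Tf := by
    rw [hTf, add_assoc, Finset.sum_range_add]
    have : ∑ k ∈ Finset.range L, f (l₀ + k) ≤ ∑ k ∈ Finset.range (L + 1), f (l₀ + k) :=
      Finset.sum_le_sum_of_subset_of_nonneg (by simp) fun _ _ _ => hf0 _
    linarith [Finset.sum_nonneg fun k (_ : k ∈ Finset.range l₀) => hf0 k]
  have hs2 : ∑ k ∈ Finset.range L, f (l₀ + (k + 1)) ≤ Tf := by
    rw [hTf, add_assoc, Finset.sum_range_add, Finset.sum_range_succ' _ L]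
    linarith [Finset.sum_nonneg fun k (_ : k ∈ Finset.range l₀) => hf0 k, hf0 (l₀ + 0)]
  have hsq2 : Real.sqrt 2 ≤ 2 := Real.sqrt_le_iff.2 ⟨by norm_num, by norm_num⟩
  have hterm : ∀ k, r (k + 1) * Real.sqrt (2 ^ (l₀ + (k + 1))) ≤
      ρ * (8 * f (l₀ + k) + 4 * f (l₀ + (k + 1))) := by
    intro k
    have h1 : Real.sqrt (2 ^ (l₀ + (k + 1))) ≤ 2 * Real.sqrt (2 ^ (l₀ + k)) := by
      rw [← add_assoc, pow_succ, Real.sqrt_mul (by positivity), mul_comm]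
      gcongr
    have h2 := mul_le_mul_of_nonneg_left h1 (hε (l₀ + k)).le
    have h3 := mul_le_mul_of_nonneg_left h2 hρ.le
    simp only [hrdef, hf]
    linarith
  have hbase : r 0 * Real.sqrt (2 ^ (l₀ + 0)) ≤ 2 * ρ * (Real.sqrt p * V) := by
    have h1 : Real.sqrt (2 ^ l₀) ≤ 2 * Real.sqrt p := by
      calc Real.sqrt (2 ^ l₀) ≤ Real.sqrt (2 * p) := Real.sqrt_le_sqrt (by exact_mod_cast hl₀')
        _ = Real.sqrt 2 * Real.sqrt p := Real.sqrt_mul (by norm_num) _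
        _ ≤ _ := by gcongr
    simp only [hrdef, add_zero]
    calc ρ * V * Real.sqrt (2 ^ l₀) ≤ ρ * V * (2 * Real.sqrt p) := by gcongr
      _ = _ := by ring
  rw [Finset.sum_range_succ']
  have h5 := Finset.sum_le_sum fun k (_ : k ∈ Finset.range L) => hterm k
  rw [← Finset.mul_sum, Finset.sum_add_distrib, ← Finset.mul_sum, ← Finset.mul_sum] at h5
  have h6 : ρ * (8 * ∑ k ∈ Finset.range L, f (l₀ + k) +
      4 * ∑ k ∈ Finset.range L, f (l₀ + (k + 1))) ≤ ρ * (12 * Tf) := by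
    gcongr
    linarith
  have h7 : 0 ≤ ρ * (Real.sqrt p * V) := by positivity
  linarith

/-! ### Symmetrization by an independent copy. -/

theorem enorm_integral_pow_le {Ω B : Type*} [MeasurableSpace Ω] {P : Measure Ω}
    [IsProbabilityMeasure P] [NormedAddCommGroup B] [NormedSpace ℝ B] {f : Ω → B}
    (hf : AEStronglyMeasurable f P) {p : ℕ} (hp : 1 ≤ p) :
    ‖∫ ω, f ω ∂P‖ₑ ^ p ≤ ∫⁻ ω, ‖f ω‖ₑ ^ p ∂P := by
  have hp' : (1 : ℝ) ≤ p := by exact_mod_cast hp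
  have h := eLpNorm'_le_eLpNorm'_of_exponent_le (p := 1) (q := p) one_pos hp' P hf
  rw [eLpNorm'_eq_lintegral_enorm, eLpNorm'_eq_lintegral_enorm] at h
  simp only [ENNReal.rpow_one, ENNReal.rpow_natCast, div_one] at h
  calc ‖∫ ω, f ω ∂P‖ₑ ^ p ≤ (∫⁻ ω, ‖f ω‖ₑ ∂P) ^ p := by
        gcongr; exact enorm_integral_le_lintegral_enorm _
    _ ≤ ((∫⁻ ω, ‖f ω‖ₑ ^ p ∂P) ^ (1 / (p : ℝ))) ^ p := by gcongr
    _ = _ := by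
        rw [← ENNReal.rpow_natCast, ← ENNReal.rpow_mul, one_div_mul_cancel (by positivity),
          ENNReal.rpow_one]

theorem enorm_sub_pow_le {B : Type*} [NormedAddCommGroup B] (x y : B) {p : ℕ} :
    ‖x - y‖ₑ ^ p ≤ 2 ^ p * (‖x‖ₑ ^ p + ‖y‖ₑ ^ p) := by
  calc ‖x - y‖ₑ ^ p ≤ (2 * max ‖x‖ₑ ‖y‖ₑ) ^ p := by
        gcongr
        rw [two_mul]
        exact enorm_sub_le.trans (add_le_add (le_max_left _ _) (le_max_right _ _))
    _ = 2 ^ p * max ‖x‖ₑ ‖y‖ₑ ^ p := mul_pow _ _ _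
    _ ≤ _ := by
        gcongr
        rcases max_cases ‖x‖ₑ ‖y‖ₑ with ⟨h, _⟩ | ⟨h, _⟩ <;> rw [h]
        · exact le_self_add
        · exact le_add_self

/-- Symmetrization, with an arbitrary fixed choice of signs. -/
theorem lintegral_enorm_sum_centered_pow_le {Ω B : Type*} [MeasurableSpace Ω] {P : Measure Ω}
    [IsProbabilityMeasure P] [NormedAddCommGroup B] [NormedSpace ℝ B] [CompleteSpace B]
    [MeasurableSpace B] [BorelSpace B] [SecondCountableTopology B] {m : ℕ} (W : Fin m → Ω → B)
    (hW : ∀ j, Measurable (W j)) (hint : ∀ j, Integrable (W j) P) (hind : iIndepFun W P)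
    {p : ℕ} (hp : 1 ≤ p) (σ : Fin m → Bool) :
    ∫⁻ ω, ‖∑ j, (W j ω - ∫ ω', W j ω' ∂P)‖ₑ ^ p ∂P ≤
      4 ^ p * ∫⁻ ω, ‖∑ j, boolSign (σ j) • W j ω‖ₑ ^ p ∂P := by
  set μ : Fin m → Measure B := fun j => P.map (W j) with hμ
  have hμp : ∀ j, IsProbabilityMeasure (μ j) := fun j =>
    Measure.isProbabilityMeasure_map (hW j).aemeasurable
  have hpi : P.map (fun ω j => W j ω) = Measure.pi μ :=
    (iIndepFun_iff_map_fun_eq_pi_map fun j => (hW j).aemeasurable).1 hind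
  have hWm : Measurable (fun ω j => W j ω) := measurable_pi_lambda _ hW
  set G : (Fin m → B) × (Fin m → B) → ℝ≥0∞ := fun z => ‖∑ j, (z.1 j - z.2 j)‖ₑ ^ p with hG
  have hGm : Measurable G := by simp only [hG]; fun_prop
  set T : (Fin m → B) → ℝ≥0∞ := fun y => ‖∑ j, boolSign (σ j) • y j‖ₑ ^ p with hT
  have hTm : Measurable T := by simp only [hT]; fun_prop
  have hTint : ∫⁻ ω, ‖∑ j, boolSign (σ j) • W j ω‖ₑ ^ p ∂P = ∫⁻ y, T y ∂(Measure.pi μ) := by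
    rw [← hpi, lintegral_map hTm hWm]
  -- The mean is an integral over an independent copy `ω'`, and Jensen's inequality moves that
  -- integral outside the norm.
  have h1 : ∀ ω, ‖∑ j, (W j ω - ∫ ω', W j ω' ∂P)‖ₑ ^ p ≤
      ∫⁻ ω', G (fun j => W j ω, fun j => W j ω') ∂P := by
    intro ω
    have hI : ∀ j ∈ Finset.univ, Integrable (fun ω' => W j ω - W j ω') P := fun j _ =>
      (integrable_const _).sub (hint j)
    have : ∑ j, (W j ω - ∫ ω', W j ω' ∂P) = ∫ ω', ∑ j, (W j ω - W j ω') ∂P := by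
      rw [integral_finsetSum _ hI]
      refine Finset.sum_congr rfl fun j _ => ?_
      rw [integral_sub (integrable_const _) (hint j)]
      simp
    rw [this]
    exact enorm_integral_pow_le (integrable_finsetSum _ hI).aestronglyMeasurable hp
  have h2 : ∫⁻ ω, ∫⁻ ω', G (fun j => W j ω, fun j => W j ω') ∂P ∂P =
      ∫⁻ z, G z ∂((Measure.pi μ).prod (Measure.pi μ)) := by
    rw [lintegral_prod _ hGm.aemeasurable, ← hpi,
      lintegral_map hGm.lintegral_prod_right' hWm]
    refine lintegral_congr fun ω => ?_
    exact (lintegral_map (hGm.comp measurable_prodMk_left) hWm).symm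
  have hE := measurePreserving_arrowProdEquivProdArrow B B (Fin m) μ μ
  -- Swapping the two copies in the coordinates with sign -1 preserves the product measure and
  -- multiplies each difference by its sign, so any fixed `σ` may be inserted.
  have hS : MeasurePreserving (fun (z : Fin m → B × B) j => (if σ j then id else Prod.swap) (z j))
      (Measure.pi fun j => (μ j).prod (μ j)) (Measure.pi fun j => (μ j).prod (μ j)) := by
    refine measurePreserving_pi (fun j => (μ j).prod (μ j)) (fun j => (μ j).prod (μ j))
      (f := fun j => if σ j then id else Prod.swap) fun j => ?_
    split_ifs
    · exact MeasurePreserving.id _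
    · exact Measure.measurePreserving_swap
  have hF1 : MeasurePreserving (fun (z : Fin m → B × B) j => (z j).1)
      (Measure.pi fun j => (μ j).prod (μ j)) (Measure.pi μ) :=
    measurePreserving_pi (fun j => (μ j).prod (μ j)) μ (f := fun j => Prod.fst)
      fun j => measurePreserving_fst
  have hF2 : MeasurePreserving (fun (z : Fin m → B × B) j => (z j).2)
      (Measure.pi fun j => (μ j).prod (μ j)) (Measure.pi μ) :=
    measurePreserving_pi (fun j => (μ j).prod (μ j)) μ (f := fun j => Prod.snd)
      fun j => measurePreserving_snd
  calc ∫⁻ ω, ‖∑ j, (W j ω - ∫ ω', W j ω' ∂P)‖ₑ ^ p ∂P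
      ≤ ∫⁻ ω, ∫⁻ ω', G (fun j => W j ω, fun j => W j ω') ∂P ∂P := lintegral_mono h1
    _ = ∫⁻ z, G (MeasurableEquiv.arrowProdEquivProdArrow B B (Fin m) z)
          ∂(Measure.pi fun j => (μ j).prod (μ j)) := by
        rw [h2, hE.lintegral_comp hGm]
    _ = ∫⁻ z, G (MeasurableEquiv.arrowProdEquivProdArrow B B (Fin m)
          (fun j => (if σ j then id else Prod.swap) (z j)))
          ∂(Measure.pi fun j => (μ j).prod (μ j)) :=
        (hS.lintegral_comp (hGm.comp hE.measurable)).symm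
    _ ≤ ∫⁻ z, 2 ^ p * (T (fun j => (z j).1) + T (fun j => (z j).2))
          ∂(Measure.pi fun j => (μ j).prod (μ j)) := by
        refine lintegral_mono fun z => ?_
        refine le_trans (le_of_eq ?_) (enorm_sub_pow_le _ _)
        rw [← Finset.sum_sub_distrib]
        change ‖∑ j, (_ - _)‖ₑ ^ p = _
        congr 2
        refine Finset.sum_congr rfl fun j _ => ?_
        cases h : σ j <;> simp [boolSign, MeasurableEquiv.arrowProdEquivProdArrow,
          Equiv.arrowProdEquivProdArrow, h]
        abel
    _ = 2 ^ p * (∫⁻ y, T y ∂(Measure.pi μ) + ∫⁻ y, T y ∂(Measure.pi μ)) := by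
        rw [lintegral_const_mul _ (by fun_prop), lintegral_add_left (by fun_prop),
          hF1.lintegral_comp hTm, hF2.lintegral_comp hTm]
    _ = (2 ^ p * 2) * ∫⁻ y, T y ∂(Measure.pi μ) := by rw [← two_mul, mul_assoc]
    _ ≤ _ := by
        rw [hTint]
        gcongr
        rw [show (4 : ℝ≥0∞) = 2 * 2 by norm_num, mul_pow]
        gcongr
        exact le_self_pow₀ (by norm_num) (by omega)

/-! ### Entropy numbers, nets and the moment bound for a fixed operator. -/

section Entropy

variable {𝕜 E F : Type*} [RCLike 𝕜] [NormedAddCommGroup E] [NormedSpace 𝕜 E]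
  [NormedAddCommGroup F] [NormedSpace 𝕜 F]

theorem entropyNumber_antitone (T : E →L[𝕜] F) : Antitone (entropyNumber T) := by
  intro a b hab
  refine le_iInf fun ε => le_iInf fun hε => le_iInf fun h => ?_
  refine iInf_le_of_le ε (iInf_le_of_le hε (iInf_le_of_le (h.trans ?_) le_rfl))
  exact pow_le_pow_right₀ (by norm_num) (by omega)

theorem entropyNumber_one_le_entropySum (T : E →L[𝕜] F) : entropyNumber T 1 ≤ entropySum T := by
  refine le_trans (le_of_eq ?_) (ENNReal.le_tsum 0)
  simp

/-- A single ball of radius ε that covers the image of the unit ball contains both `T x` and `-T x`,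
so 2‖T x‖ ≤ 2ε. -/
theorem enorm_le_entropyNumber_one (T : E →L[𝕜] F) : ‖T‖ₑ ≤ entropyNumber T 1 := by
  refine le_iInf fun ε => le_iInf fun hε => le_iInf fun h => ?_
  have hN : ‖T‖ ≤ ε := by
    simp only [le_refl, tsub_eq_zero_of_le, pow_zero] at h
    have : ∃ c, ∀ x : E, ‖x‖ ≤ 1 → ‖T x - c‖ ≤ ε := by
      have hlt : Metric.externalCoveringNumber ε (T '' Metric.closedBall 0 1) < 2 :=
        h.trans_lt (by norm_num)
      rw [Metric.externalCoveringNumber] at hlt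
      simp only [iInf_lt_iff] at hlt
      obtain ⟨C, hC, hcard⟩ := hlt
      have hsub : C.Subsingleton := by
        rw [← Set.encard_le_one_iff_subsingleton]
        exact ENat.lt_add_one_iff (by norm_num) |>.1 (hcard.trans_eq (by norm_num))
      have h0 : (T 0) ∈ T '' Metric.closedBall 0 1 := ⟨0, by simp, rfl⟩
      obtain ⟨c, hc, -⟩ := hC h0
      refine ⟨c, fun x hx => ?_⟩
      obtain ⟨c', hc', hd⟩ := hC (⟨x, by simpa using hx, rfl⟩ : T x ∈ T '' Metric.closedBall 0 1)
      rw [hsub hc' hc] at hd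
      have hd' : edist (T x) c ≤ ε := hd
      rw [edist_nndist, ENNReal.coe_le_coe] at hd'
      rw [← dist_eq_norm, ← coe_nndist]
      exact_mod_cast hd'
    obtain ⟨c, hc⟩ := this
    refine T.opNorm_le_of_unit_norm ε.2 fun x hx => ?_
    have h1 := hc x hx.le
    have h2 := hc (-x) (by rw [norm_neg]; exact hx.le)
    have h3 := norm_sub_le (T x - c) (T (-x) - c)
    rw [map_neg] at h2 h3
    rw [sub_sub_sub_cancel_right, sub_neg_eq_add, ← two_smul 𝕜, norm_smul,
      RCLike.norm_ofNat] at h3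
    linarith
  rw [enorm_eq_nnnorm, ENNReal.coe_le_coe]
  exact hN

theorem enorm_le_entropySum (T : E →L[𝕜] F) : ‖T‖ₑ ≤ entropySum T :=
  (enorm_le_entropyNumber_one T).trans (entropyNumber_one_le_entropySum T)

/-- Cauchy condensation: √(2^n) e_{2^n} is 2^n times the term e_l/√l at l = 2^n. It converts the
entropy sum into the dyadic sum that chaining produces. -/
theorem tsum_sqrt_mul_entropyNumber_le (T : E →L[𝕜] F) :
    ∑' n : ℕ, ENNReal.ofReal (Real.sqrt (2 ^ n)) * entropyNumber T (2 ^ n) ≤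
      3 * entropySum T := by
  -- The value 0 at index 0 keeps the total unchanged; condensation needs monotonicity only beyond
  -- index 1.
  set f : ℕ → ℝ≥0∞ := fun l =>
    if l = 0 then 0 else entropyNumber T l / ENNReal.ofReal (Real.sqrt l) with hf
  have hanti : ∀ ⦃a b⦄, 1 < a → a ≤ b → f b ≤ f a := by
    intro a b ha hab
    simp only [hf, show a ≠ 0 by omega, show b ≠ 0 by omega, if_false]
    exact ENNReal.div_le_div (entropyNumber_antitone T hab)
      (ENNReal.ofReal_le_ofReal (Real.sqrt_le_sqrt (by exact_mod_cast hab)))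
  have h := ENNReal.tsum_condensed_le hanti
  have hsum : ∑' k, f k = entropySum T := by
    rw [tsum_eq_zero_add' ENNReal.summable, entropySum]
    simp [hf]
  have h1 : f 1 ≤ entropySum T := by
    simpa only [hf, one_ne_zero, if_false, Nat.cast_one, Real.sqrt_one, ENNReal.ofReal_one, div_one]
      using entropyNumber_one_le_entropySum T
  have hterm : ∀ n : ℕ, ENNReal.ofReal (Real.sqrt (2 ^ n)) * entropyNumber T (2 ^ n) =
      2 ^ n * f (2 ^ n) := by
    intro n
    have hs : 0 < Real.sqrt (2 ^ n : ℝ) := by positivity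
    have h2 : (2 : ℝ≥0∞) ^ n =
        ENNReal.ofReal (Real.sqrt (2 ^ n)) * ENNReal.ofReal (Real.sqrt (2 ^ n)) := by
      rw [← ENNReal.ofReal_mul hs.le, Real.mul_self_sqrt (by positivity),
        ENNReal.ofReal_pow (by norm_num)]
      norm_num
    have h0 : ENNReal.ofReal (Real.sqrt (2 ^ n)) ≠ 0 :=
      (ENNReal.ofReal_pos.2 hs).ne'
    simp only [hf, show (2 ^ n : ℕ) ≠ 0 by positivity, if_false]
    rw [h2]
    push_cast
    rw [mul_assoc, ENNReal.mul_div_cancel h0 ENNReal.ofReal_ne_top]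
  simp_rw [hterm]
  calc _ ≤ _ := h
    _ ≤ entropySum T + 2 * entropySum T := by rw [hsum]; gcongr
    _ = 3 * entropySum T := by ring

/-- The centres of the cover need not belong to the family; replacing them by members doubles the
radius. The bound `2 ^ l`, weaker than `2 ^ (l - 1)`, is enough for chaining. -/
theorem exists_net_of_entropyNumber_lt {ι : Type*} [Finite ι] (T : E →L[𝕜] F) {l : ℕ} {ε : ℝ}
    (h : entropyNumber T l < ENNReal.ofReal ε) (x : ι → E) (hx : ∀ i, ‖x i‖ ≤ 1) :
    ∃ π : ι → ι, (Set.range π).ncard ≤ 2 ^ l ∧ ∀ i, ‖T (x i) - T (x (π i))‖ ≤ 2 * ε := by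
  simp only [entropyNumber, iInf_lt_iff] at h
  obtain ⟨ε', hε', hcov, hlt⟩ := h
  have hεle : (ε' : ℝ) ≤ ε := by
    have h0 : 0 ≤ ε := by
      by_contra hneg
      rw [ENNReal.ofReal_of_nonpos (not_le.1 hneg).le] at hlt
      exact not_lt_bot hlt
    have := hlt.le
    rw [← ENNReal.ofReal_coe_nnreal] at this
    exact (ENNReal.ofReal_le_ofReal_iff h0).1 this
  have hsub : Set.range (fun i => T (x i)) ⊆ T '' Metric.closedBall 0 1 := by
    rintro _ ⟨i, rfl⟩
    exact ⟨x i, by simpa using hx i, rfl⟩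
  have hc : Metric.coveringNumber (2 * ε') (Set.range fun i => T (x i)) ≤ 2 ^ l :=
    (Metric.coveringNumber_two_mul_le_externalCoveringNumber _ _).trans
      ((Metric.externalCoveringNumber_mono_set hsub).trans
        (hcov.trans (pow_le_pow_right₀ (by norm_num) (by omega))))
  have hclt : Metric.coveringNumber (2 * ε') (Set.range fun i => T (x i)) < 2 ^ l + 1 :=
    lt_of_le_of_lt hc (ENat.lt_add_one_iff (by norm_cast; exact ENat.natCast_ne_top _) |>.2 le_rfl)
  simp only [Metric.coveringNumber, iInf_lt_iff] at hclt
  obtain ⟨C, hC, hcover, hcard⟩ := hclt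
  have hcard' : C.encard ≤ 2 ^ l :=
    ENat.lt_add_one_iff (by norm_cast; exact ENat.natCast_ne_top _) |>.1 hcard
  have hCfin : C.Finite := (Set.finite_range _).subset hC
  choose g hg using fun c : C => hC c.2
  choose k hk hk' using fun i => hcover (Set.mem_range_self (f := fun i => T (x i)) i)
  refine ⟨fun i => g ⟨k i, hk i⟩, ?_, fun i => ?_⟩
  · have : Finite C := hCfin
    calc _ ≤ (Set.range g).ncard :=
          Set.ncard_le_ncard (by rintro _ ⟨i, rfl⟩; exact ⟨_, rfl⟩) (Set.toFinite _)
      _ ≤ Nat.card C := by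
          rw [← Set.image_univ, ← Set.ncard_univ]
          exact Set.ncard_image_le (Set.toFinite _)
      _ ≤ 2 ^ l := by
          rw [Nat.card_coe_set_eq]
          rw [← hCfin.cast_ncard_eq] at hcard'
          exact_mod_cast hcard'
  · have h1 : edist (T (x i)) (k i) ≤ ((2 * ε' : ℝ≥0) : ℝ≥0∞) := hk' i
    have h2 : T (x (g ⟨k i, hk i⟩)) = k i := hg ⟨k i, hk i⟩
    rw [h2, ← dist_eq_norm, ← coe_nndist]
    rw [edist_nndist, ENNReal.coe_le_coe] at h1
    have h3 : (nndist (T (x i)) (k i) : ℝ) ≤ 2 * ε' := by exact_mod_cast h1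
    linarith

end Entropy

theorem sum_sqrt_two_pow_mul_quarter_le (N : ℕ) :
    ∑ n ∈ Finset.range N, Real.sqrt (2 ^ n) * (1 / 4 : ℝ) ^ n ≤ 2 := by
  have h : ∀ n, Real.sqrt (2 ^ n) * (1 / 4 : ℝ) ^ n ≤ (1 / 2 : ℝ) ^ n := by
    intro n
    have : Real.sqrt (2 ^ n) ≤ 2 ^ n :=
      Real.sqrt_le_iff.2 ⟨by positivity, le_self_pow₀ (one_le_pow₀ (by norm_num)) (by norm_num)⟩
    calc _ ≤ (2 : ℝ) ^ n * (1 / 4 : ℝ) ^ n := by gcongr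
      _ = (1 / 2 : ℝ) ^ n := by rw [← mul_pow]; norm_num
  calc _ ≤ ∑ n ∈ Finset.range N, (1 / 2 : ℝ) ^ n := Finset.sum_le_sum fun n _ => h n
    _ ≤ 2 := sum_geometric_two_le N

/-- Moments of `sup_i |∑ j, ± ‖(T (t i)) j‖ ^ 2|` in terms of the entropy numbers of `T`. -/
theorem rademacher_operator_moment_le {𝕜 E F ι : Type*} [RCLike 𝕜] [NormedAddCommGroup E]
    [NormedSpace 𝕜 E] [NormedAddCommGroup F] [NormedSpace 𝕜 F] [Fintype ι] {m : ℕ}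
    (T : E →L[𝕜] (Fin m → F)) (t : ι → E) {s : ℝ} (hs : 0 < s) (ht : ∀ i, ‖t i‖ ≤ Real.sqrt s)
    {ρ V τ : ℝ} (hρ : 0 < ρ) (hV : 0 ≤ V) (hτ : 0 < τ)
    (hTρ : ∀ i, ∑ j, ‖T (t i) j‖ ^ 2 ≤ ρ ^ 2) (hTV : ∀ i, ‖T (t i)‖ ≤ Real.sqrt s * V)
    {p : ℕ} (hp : 0 < p) :
    ENNReal.ofReal (∑ σ : Fin m → Bool, ‖fun i => ∑ j, boolSign (σ j) * ‖T (t i) j‖ ^ 2‖ ^ p) ≤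
      2 ^ m * (ENNReal.ofReal (720 * Real.sqrt s * ρ) *
        (entropySum T + ENNReal.ofReal (Real.sqrt p * (V + τ)))) ^ p := by
  have hs' : 0 < Real.sqrt s := Real.sqrt_pos.2 hs
  have hcoef : ENNReal.ofReal (720 * Real.sqrt s * ρ) ≠ 0 := by
    rw [ENNReal.ofReal_ne_zero_iff]; positivity
  by_cases htop : entropySum T = ⊤
  · rw [htop, top_add, ENNReal.mul_top hcoef, ENNReal.top_pow hp.ne', ENNReal.mul_top (by positivity)]
    exact le_top
  have hsumle := tsum_sqrt_mul_entropyNumber_le T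
  have hsumtop : ∑' n : ℕ, ENNReal.ofReal (Real.sqrt (2 ^ n)) * entropyNumber T (2 ^ n) ≠ ⊤ :=
    ne_top_of_le_ne_top (ENNReal.mul_ne_top (by norm_num) htop) hsumle
  have hetop : ∀ n, entropyNumber T (2 ^ n) ≠ ⊤ := by
    intro n hn
    have := ENNReal.ne_top_of_tsum_ne_top hsumtop n
    rw [hn, ENNReal.mul_top (by simp)] at this
    exact this rfl
  set e : ℕ → ℝ := fun n => (entropyNumber T (2 ^ n)).toReal with he
  have he0 : ∀ n, 0 ≤ e n := fun n => ENNReal.toReal_nonneg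
  -- Infima need not be attained and entropy numbers may vanish. The slack makes the radii strictly
  -- larger and positive, and its √(2^n)-weighted sum is at most 2τ.
  set ε : ℕ → ℝ := fun n => e n + τ * (1 / 4) ^ n with hε
  have hε0 : ∀ n, 0 < ε n := fun n => add_pos_of_nonneg_of_pos (he0 n) (by positivity)
  have hscale : ∀ i, T (t i) = ((Real.sqrt s : ℝ) : 𝕜) • T ((((Real.sqrt s)⁻¹ : ℝ) : 𝕜) • t i) := by
    intro i
    rw [← map_smul, smul_smul, ← RCLike.ofReal_mul, mul_inv_cancel₀ hs'.ne', RCLike.ofReal_one,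
      one_smul]
  have hnet : ∀ n, ∃ π : ι → ι, (Set.range π).ncard ≤ 2 ^ 2 ^ n ∧
      ∀ i, ‖T (t i) - T (t (π i))‖ ≤ 2 * (Real.sqrt s * ε n) := by
    intro n
    obtain ⟨π, hπ, hπ'⟩ := exists_net_of_entropyNumber_lt T (l := 2 ^ n) (ε := ε n) (by
      rw [← ENNReal.ofReal_toReal (hetop n)]
      refine (ENNReal.ofReal_lt_ofReal_iff (hε0 n)).2 ?_
      simp only [hε, he]
      linarith [show 0 < τ * (1 / 4) ^ n by positivity])
      (fun i => (((Real.sqrt s)⁻¹ : ℝ) : 𝕜) • t i) (fun i => by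
        rw [norm_smul, RCLike.norm_ofReal, abs_of_pos (by positivity), inv_mul_le_one₀ hs']
        exact ht i)
    refine ⟨π, hπ, fun i => ?_⟩
    rw [hscale i, hscale (π i), ← smul_sub, norm_smul, RCLike.norm_ofReal, abs_of_pos hs']
    have := mul_le_mul_of_nonneg_left (hπ' i) hs'.le
    linarith
  obtain ⟨N, hN⟩ := rademacher_norm_sq_moment_le (fun i => T (t i)) hρ
    (mul_pos hs' (add_pos_of_nonneg_of_pos hV hτ)) hTρ
    (fun i => (hTV i).trans (by gcongr; linarith)) (fun n => Real.sqrt s * ε n)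
    (fun n => mul_pos hs' (hε0 n)) hnet hp
  have hsum : ∑ n ∈ Finset.range N, Real.sqrt (2 ^ n) * e n ≤ 3 * (entropySum T).toReal := by
    have h1 : ∑ n ∈ Finset.range N, ENNReal.ofReal (Real.sqrt (2 ^ n)) * entropyNumber T (2 ^ n) ≤
        3 * entropySum T := (ENNReal.sum_le_tsum _).trans hsumle
    have h2 := ENNReal.toReal_mono (ENNReal.mul_ne_top (by norm_num) htop) h1
    rw [ENNReal.toReal_sum fun n _ => ENNReal.mul_ne_top ENNReal.ofReal_ne_top (hetop n)] at h2
    simp only [ENNReal.toReal_mul, ENNReal.toReal_ofReal (Real.sqrt_nonneg _)] at h2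
    simpa using h2
  have hp1 : 1 ≤ Real.sqrt p := Real.one_le_sqrt.2 (by exact_mod_cast hp)
  set Z := (entropySum T).toReal with hZ
  have hZ0 : 0 ≤ Z := ENNReal.toReal_nonneg
  have hbound : 240 * ρ * (Real.sqrt p * (Real.sqrt s * (V + τ)) +
      ∑ n ∈ Finset.range N, Real.sqrt (2 ^ n) * (Real.sqrt s * ε n)) ≤
      720 * Real.sqrt s * ρ * (Z + Real.sqrt p * (V + τ)) := by
    have h1 : ∑ n ∈ Finset.range N, Real.sqrt (2 ^ n) * (Real.sqrt s * ε n) =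
        Real.sqrt s * (∑ n ∈ Finset.range N, Real.sqrt (2 ^ n) * e n +
          τ * ∑ n ∈ Finset.range N, Real.sqrt (2 ^ n) * (1 / 4 : ℝ) ^ n) := by
      rw [Finset.mul_sum _ _ τ, ← Finset.sum_add_distrib, Finset.mul_sum]
      exact Finset.sum_congr rfl fun n _ => by simp only [hε]; ring
    have h2 : ∑ n ∈ Finset.range N, Real.sqrt (2 ^ n) * e n +
          τ * ∑ n ∈ Finset.range N, Real.sqrt (2 ^ n) * (1 / 4 : ℝ) ^ n ≤ 3 * Z + 2 * τ := by
      have := mul_le_mul_of_nonneg_left (sum_sqrt_two_pow_mul_quarter_le N) hτ.le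
      linarith
    have h3 : τ ≤ Real.sqrt p * (V + τ) := by nlinarith
    rw [h1]
    calc _ ≤ 240 * ρ * (Real.sqrt p * (Real.sqrt s * (V + τ)) + Real.sqrt s * (3 * Z + 2 * τ)) := by
          gcongr
      _ = 240 * ρ * Real.sqrt s * (Real.sqrt p * (V + τ) + 3 * Z + 2 * τ) := by ring
      _ ≤ 240 * ρ * Real.sqrt s * (3 * (Z + Real.sqrt p * (V + τ))) := by
          gcongr
          linarith
      _ = _ := by ring
  have hfin := hN.trans (mul_le_mul_of_nonneg_left (pow_le_pow_left₀
    (mul_nonneg (by positivity) (add_nonneg (by positivity) (Finset.sum_nonneg fun n _ =>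
      mul_nonneg (Real.sqrt_nonneg _) (mul_nonneg hs'.le (hε0 n).le)))) hbound p) (by positivity))
  refine (ENNReal.ofReal_le_ofReal hfin).trans (le_of_eq ?_)
  rw [ENNReal.ofReal_mul (by positivity), ENNReal.ofReal_pow (by norm_num),
    ENNReal.ofReal_pow (by positivity), ENNReal.ofReal_mul (by positivity),
    ENNReal.ofReal_add hZ0 (by positivity), hZ, ENNReal.ofReal_toReal htop]
  norm_num

/-! ### From arbitrary index sets to finite ones. -/

/-- Continuity from below along an enumeration of `D`; for increasing unions it requires no
measurability of the events. -/
theorem measure_exists_mem_le_of_forall_finset {Ω X : Type*} [MeasurableSpace Ω] (P : Measure Ω)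
    (Q : Ω → X → Prop) {D : Set X} (hD : D.Countable) {ζ : ℝ≥0∞}
    (h : ∀ F : Finset X, (F : Set X) ⊆ D → P {ω | ∃ x ∈ F, Q ω x} ≤ ζ) :
    P {ω | ∃ x ∈ D, Q ω x} ≤ ζ := by
  classical
  rcases D.eq_empty_or_nonempty with rfl | hne
  · simp
  obtain ⟨f, rfl⟩ := hD.exists_eq_range hne
  have heq : {ω | ∃ x ∈ Set.range f, Q ω x} =
      ⋃ n : ℕ, {ω | ∃ x ∈ (Finset.range n).image f, Q ω x} := by
    ext ω
    simp only [Set.mem_range, exists_exists_eq_and, Set.mem_ofPred_eq, Finset.mem_image,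
      Finset.mem_range, Set.mem_iUnion]
    constructor
    · rintro ⟨k, hk⟩
      exact ⟨k + 1, f k, ⟨k, by omega, rfl⟩, hk⟩
    · rintro ⟨n, x, ⟨k, -, rfl⟩, hk⟩
      exact ⟨k, hk⟩
  have hmono : Monotone fun n : ℕ => {ω | ∃ x ∈ (Finset.range n).image f, Q ω x} := by
    rintro a b hab ω ⟨x, hx, hQ⟩
    exact ⟨x, Finset.image_subset_image (Finset.range_subset_range.2 hab) hx, hQ⟩
  rw [heq, hmono.measure_iUnion]
  refine iSup_le fun n => h _ ?_
  rw [Finset.coe_image]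
  exact Set.image_subset_range _ _

/-- A supremum over an arbitrary index set exceeds a level almost surely only if the supremum over
a suitable countable subset does. -/
theorem exists_countable_forall_ae_exists_lt {Ω X Y : Type*} [MeasurableSpace Ω] {P : Measure Ω}
    [PseudoMetricSpace X] [PseudoMetricSpace Y] (G : Y → X → ℝ≥0∞)
    (hX : ∀ y, Continuous (G y)) (hY : ∀ x, Continuous fun y => G y x) (V : Ω → Y)
    (hsep : TopologicalSpace.SeparableSpace X ∨
      ∃ S : Set Y, TopologicalSpace.IsSeparable S ∧ ∀ᵐ ω ∂P, V ω ∈ S) (A : Set X) (a : ℝ≥0∞) :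
    ∃ D ⊆ A, D.Countable ∧ ∀ᵐ ω ∂P, (∃ x ∈ A, a < G (V ω) x) → ∃ x ∈ D, a < G (V ω) x := by
  rcases hsep with hX' | ⟨S, hS, hVS⟩
  · obtain ⟨D, hDA, hDc, hAD⟩ :=
      (TopologicalSpace.IsSeparable.of_separableSpace A).exists_countable_dense_subset
    refine ⟨D, hDA, hDc, Filter.Eventually.of_forall fun ω => ?_⟩
    rintro ⟨x, hx, hax⟩
    obtain ⟨y, hy, hyD⟩ := mem_closure_iff.1 (hAD hx) _ (isOpen_lt continuous_const (hX (V ω))) hax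
    exact ⟨y, hyD, hy⟩
  · have := hS.secondCountableTopology
    -- Lindelöf's property in operator space: countably many of the open sets of operators that
    -- exceed the level at some `x ∈ A` have the same union as all of them.
    obtain ⟨D, hDA, hDc, hU⟩ := TopologicalSpace.isOpen_biUnion_countable A
      (fun x => {y : S | a < G y x})
      (fun x _ => isOpen_lt continuous_const ((hY x).comp continuous_subtype_val))
    refine ⟨D, hDA, hDc, ?_⟩
    filter_upwards [hVS] with ω hω
    rintro ⟨x, hx, hax⟩
    have hmem : (⟨V ω, hω⟩ : S) ∈ ⋃ x ∈ A, {y : S | a < G y x} := Set.mem_biUnion hx hax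
    rw [← hU] at hmem
    obtain ⟨x', hx', h'⟩ := Set.mem_iUnion₂.1 hmem
    exact ⟨x', hx', h'⟩

theorem exists_isSeparable_pi_ae_mem {Ω Y : Type*} [MeasurableSpace Ω] {P : Measure Ω}
    [PseudoMetricSpace Y] {m : ℕ} {v : Fin m → Ω → Y} (hv : ∀ j, AEStronglyMeasurable (v j) P) :
    ∃ S : Set (Fin m → Y), TopologicalSpace.IsSeparable S ∧ ∀ᵐ ω ∂P, (fun j => v j ω) ∈ S := by
  choose t ht ht' using fun j => (hv j).isSeparable_ae_range
  refine ⟨Set.univ.pi t, TopologicalSpace.IsSeparable.univ_pi ht, ?_⟩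
  filter_upwards [ae_all_iff.2 ht'] with ω hω j _
  exact hω j

/-! ### Moment inequalities in L^k. -/

section Moments

variable {Ω : Type*} [MeasurableSpace Ω] {P : Measure Ω}

/-- The entropy sum of a random operator is not known to be measurable, which blocks Minkowski and
Cauchy–Schwarz. Solving the inequality for `g`, with truncated subtraction, gives a measurable
function that can take its place. -/
theorem exists_measurable_minorant {H R N g : Ω → ℝ≥0∞} (hH : Measurable H) (hR : Measurable R)
    (hN : Measurable N) (hR0 : ∀ ω, R ω ≠ 0) (hRt : ∀ ω, R ω ≠ ⊤) {p : ℕ} (hp : p ≠ 0)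
    (h : ∀ ω, H ω ≤ (R ω * (g ω + N ω)) ^ p) :
    ∃ g' : Ω → ℝ≥0∞, Measurable g' ∧ (∀ ω, g' ω ≤ g ω) ∧
      ∀ ω, H ω ≤ (R ω * (g' ω + N ω)) ^ p := by
  refine ⟨fun ω => H ω ^ (p : ℝ)⁻¹ / R ω - N ω, by fun_prop, fun ω => ?_, fun ω => ?_⟩
  · rw [tsub_le_iff_right]
    refine ENNReal.div_le_of_le_mul' ?_
    rw [ENNReal.rpow_inv_le_iff (by positivity), ENNReal.rpow_natCast]
    exact h ω
  · have h1 : H ω ^ (p : ℝ)⁻¹ ≤ R ω * (H ω ^ (p : ℝ)⁻¹ / R ω - N ω + N ω) := by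
      calc H ω ^ (p : ℝ)⁻¹ = R ω * (H ω ^ (p : ℝ)⁻¹ / R ω) :=
            (ENNReal.mul_div_cancel (hR0 ω) (hRt ω)).symm
        _ ≤ _ := by gcongr; exact le_tsub_add
    rw [ENNReal.rpow_inv_le_iff (by positivity), ENNReal.rpow_natCast] at h1
    exact h1

theorem evenMoment_mono {f g : Ω → ℝ≥0∞} (h : ∀ ω, f ω ≤ g ω) (k : ℕ) :
    evenMoment P f k ≤ evenMoment P g k := by
  unfold evenMoment
  gcongr with ω
  exact h ω

theorem evenMoment_const [IsProbabilityMeasure P] (c : ℝ≥0∞) {k : ℕ} (hk : 1 ≤ k) :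
    evenMoment P (fun _ => c) k = c := by
  unfold evenMoment
  rw [lintegral_const, measure_univ, mul_one, ← ENNReal.rpow_natCast, ← ENNReal.rpow_mul]
  push_cast
  rw [mul_one_div_cancel (by positivity), ENNReal.rpow_one]

theorem evenMoment_const_mul (c : ℝ≥0∞) {f : Ω → ℝ≥0∞} (hf : Measurable f) {k : ℕ}
    (hk : 1 ≤ k) : evenMoment P (fun ω => c * f ω) k = c * evenMoment P f k := by
  unfold evenMoment
  simp_rw [mul_pow]
  rw [lintegral_const_mul _ (by fun_prop), ENNReal.mul_rpow_of_nonneg _ _ (by positivity),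
    ← ENNReal.rpow_natCast c, ← ENNReal.rpow_mul]
  push_cast
  rw [mul_one_div_cancel (by positivity), ENNReal.rpow_one]

theorem lintegral_pow_add_rpow_le {f g : Ω → ℝ≥0∞} (hf : Measurable f) (hg : Measurable g) {n : ℕ}
    (hn : 1 ≤ n) :
    (∫⁻ ω, (f ω + g ω) ^ n ∂P) ^ (1 / (n : ℝ)) ≤
      (∫⁻ ω, f ω ^ n ∂P) ^ (1 / (n : ℝ)) + (∫⁻ ω, g ω ^ n ∂P) ^ (1 / (n : ℝ)) := by
  have h := ENNReal.lintegral_Lp_add_le (μ := P) (p := n) hf.aemeasurable hg.aemeasurable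
    (by exact_mod_cast hn)
  simpa only [ENNReal.rpow_natCast, Pi.add_apply] using h

theorem evenMoment_add_le {f g : Ω → ℝ≥0∞} (hf : Measurable f) (hg : Measurable g) {k : ℕ}
    (hk : 1 ≤ k) : evenMoment P (fun ω => f ω + g ω) k ≤ evenMoment P f k + evenMoment P g k := by
  have h := lintegral_pow_add_rpow_le (P := P) hf hg (n := 2 * k) (by omega)
  push_cast at h
  exact h

/-- Cauchy–Schwarz: the square root leaves `f` with its k-th moment, while `g` pays with its 2k-th.
This is the source of the even moments in the hypothesis. -/
theorem lintegral_sqrt_mul_pow_rpow_le {f g : Ω → ℝ≥0∞} (hf : Measurable f) (hg : Measurable g)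
    {k : ℕ} (hk : 1 ≤ k) :
    (∫⁻ ω, (f ω ^ (1 / 2 : ℝ) * g ω) ^ k ∂P) ^ (1 / (k : ℝ)) ≤
      ((∫⁻ ω, f ω ^ k ∂P) ^ (1 / (k : ℝ))) ^ (1 / 2 : ℝ) * evenMoment P g k := by
  have hk' : (k : ℝ) ≠ 0 := by positivity
  have h := ENNReal.lintegral_mul_le_Lp_mul_Lq P (p := 2) (q := 2)
    Real.HolderConjugate.two_two
    (f := fun ω => (f ω ^ (1 / 2 : ℝ)) ^ k) (g := fun ω => g ω ^ k)
    (by fun_prop) (by fun_prop)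
  have e1 : ∀ ω, ((f ω ^ (1 / 2 : ℝ)) ^ k) ^ (2 : ℝ) = f ω ^ k := by
    intro ω
    rw [← ENNReal.rpow_natCast, ← ENNReal.rpow_mul, ← ENNReal.rpow_mul, ← ENNReal.rpow_natCast]
    congr 1
    ring
  have e2 : ∀ ω, (g ω ^ k) ^ (2 : ℝ) = g ω ^ (2 * k) := by
    intro ω
    rw [ENNReal.rpow_two, ← pow_mul, mul_comm]
  simp only [Pi.mul_apply, e1, e2, ← mul_pow] at h
  calc _ ≤ ((∫⁻ ω, f ω ^ k ∂P) ^ (1 / 2 : ℝ) *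
        (∫⁻ ω, g ω ^ (2 * k) ∂P) ^ (1 / 2 : ℝ)) ^ (1 / (k : ℝ)) := by gcongr
    _ = _ := by
        rw [ENNReal.mul_rpow_of_nonneg _ _ (by positivity), evenMoment, ← ENNReal.rpow_mul,
          ← ENNReal.rpow_mul, ← ENNReal.rpow_mul]
        congr 2
        · ring
        · field_simp

end Moments

/-- Squaring gives z² ≤ A²(1 + z), whose positive root is at most A + A². Finiteness is essential,
since z = ⊤ satisfies the inequality for every A ≠ 0. -/
theorem le_add_sq_of_le_mul_sqrt {z A : ℝ≥0∞} (hz : z ≠ ⊤)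
    (h : z ≤ A * (1 + z) ^ (1 / 2 : ℝ)) : z ≤ A + A ^ 2 := by
  by_cases hA : A = ⊤
  · simp [hA]
  lift z to ℝ≥0 using hz
  lift A to ℝ≥0 using hA
  have h2 : (z : ℝ≥0∞) ^ 2 ≤ (A : ℝ≥0∞) ^ 2 * (1 + z) := by
    calc (z : ℝ≥0∞) ^ 2 ≤ ((A : ℝ≥0∞) * (1 + z) ^ (1 / 2 : ℝ)) ^ 2 := by gcongr
      _ = (A : ℝ≥0∞) ^ 2 * (1 + z) := by
        rw [mul_pow, ← ENNReal.rpow_natCast (_ ^ (1 / 2 : ℝ)), ← ENNReal.rpow_mul]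
        norm_num
  have h3 : (z : ℝ) ^ 2 ≤ (A : ℝ) ^ 2 * (1 + z) := by exact_mod_cast h2
  have h4 : (z : ℝ) ≤ A + (A : ℝ) ^ 2 := by
    by_contra hlt
    have hlt := not_le.1 hlt
    have hA0 : (0 : ℝ) ≤ A := A.2
    nlinarith [mul_nonneg hA0 (sq_nonneg (A : ℝ)), z.2]
  exact_mod_cast h4

/-! ### The deviation inequality over finitely many points. -/

/-- Moment estimate for the deviation of `(1 / m) ∑ j, ‖v j x‖ ^ 2` from its mean `μ`, uniformly over
finitely many points `x = t i` with `‖t i‖ ≤ √s`. -/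
theorem deviation_moment_le {𝕜 E F ι Ω : Type*} [RCLike 𝕜] [NormedAddCommGroup E]
    [NormedSpace 𝕜 E] [NormedAddCommGroup F] [NormedSpace 𝕜 F] [Fintype ι] [MeasurableSpace Ω]
    {P : Measure Ω} [IsProbabilityMeasure P] {m : ℕ} (hm : 0 < m)
    (v : Fin m → Ω → E →L[𝕜] F) (t : ι → E) {s : ℝ} (hs : 0 < s) (ht : ∀ i, ‖t i‖ ≤ Real.sqrt s)
    (hmeas : ∀ j i, Measurable fun ω => ‖v j ω (t i)‖)
    (hint : ∀ j i, Integrable (fun ω => ‖v j ω (t i)‖ ^ 2) P)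
    (hind : iIndepFun (fun j ω (i : ι) => ‖v j ω (t i)‖ ^ 2) P)
    (μ : ι → ℝ) (hμ : ∀ i, μ i ≤ 1) (hmean : ∀ j i, ∫ ω, ‖v j ω (t i)‖ ^ 2 ∂P = μ i)
    {k : ℕ} (hk : 1 ≤ k) {τ : ℝ} (hτ : 0 < τ)
    (Z : Ω → ι → ℝ) (hZ : Z = fun ω i => 1 / (m : ℝ) * ∑ j, ‖v j ω (t i)‖ ^ 2 - μ i)
    (A : ℝ≥0∞) (hA : A = ENNReal.ofReal (2880 * Real.sqrt s / Real.sqrt m) *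
        (evenMoment P (fun ω => entropySum (ContinuousLinearMap.pi fun j => v j ω)) k +
          ENNReal.ofReal (Real.sqrt k) *
            (evenMoment P (fun ω => ‖ContinuousLinearMap.pi fun j => v j ω‖ₑ) k +
              ENNReal.ofReal τ))) :
    (∫⁻ ω, ‖Z ω‖ₑ ^ k ∂P) ^ (1 / (k : ℝ)) ≤
      A * (1 + (∫⁻ ω, ‖Z ω‖ₑ ^ k ∂P) ^ (1 / (k : ℝ))) ^ (1 / 2 : ℝ) := by
  have hm' : (0 : ℝ) < m := by exact_mod_cast hm
  have hsm : 0 < Real.sqrt m := Real.sqrt_pos.2 hm'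
  have hs' : 0 < Real.sqrt s := Real.sqrt_pos.2 hs
  set T : Ω → E →L[𝕜] (Fin m → F) := fun ω => ContinuousLinearMap.pi fun j => v j ω with hT
  set W : Fin m → Ω → ι → ℝ := fun j ω i => ‖v j ω (t i)‖ ^ 2 with hW
  have hWm : ∀ j, Measurable (W j) := fun j =>
    measurable_pi_lambda _ fun i => (hmeas j i).pow_const 2
  have hWint : ∀ j, Integrable (W j) P := fun j => Integrable.of_eval fun i => hint j i
  have hWmean : ∀ j, ∫ ω, W j ω ∂P = μ := by
    intro j
    ext i
    rw [eval_integral fun i => hint j i]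
    exact hmean j i
  have hZm : Measurable Z := by
    rw [hZ]
    refine measurable_pi_lambda _ fun i => ?_
    exact ((Finset.measurable_sum _ fun j _ => (hmeas j i).pow_const 2).const_mul _).sub_const _
  have hZsum : ∀ ω, ‖∑ j, (W j ω - ∫ ω', W j ω' ∂P)‖ₑ = ENNReal.ofReal m * ‖Z ω‖ₑ := by
    intro ω
    have : ∑ j, (W j ω - ∫ ω', W j ω' ∂P) = (m : ℝ) • Z ω := by
      simp_rw [hWmean]
      ext i
      simp only [Finset.sum_sub_distrib, hZ, Finset.sum_apply, Pi.sub_apply, Pi.smul_apply,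
        smul_eq_mul, Finset.sum_const, Finset.card_univ, Fintype.card_fin, nsmul_eq_mul, hW]
      field_simp
    rw [this, enorm_smul, Real.enorm_of_nonneg hm'.le]
  set H : Ω → ℝ≥0∞ := fun ω => ENNReal.ofReal (∑ σ : Fin m → Bool,
    ‖fun i => ∑ j, boolSign (σ j) * ‖T ω (t i) j‖ ^ 2‖ ^ k) with hH
  have hSm : ∀ σ : Fin m → Bool,
      Measurable fun ω => fun i => ∑ j, boolSign (σ j) * ‖T ω (t i) j‖ ^ 2 := fun σ =>
    measurable_pi_lambda _ fun i => Finset.measurable_sum _ fun j _ =>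
      ((hmeas j i).pow_const 2).const_mul _
  have hHm : Measurable H := by
    refine ENNReal.measurable_ofReal.comp (Finset.measurable_sum _ fun σ _ => ?_)
    exact ((hSm σ).norm).pow_const k
  have hsymm : 2 ^ m * ∫⁻ ω, (ENNReal.ofReal m * ‖Z ω‖ₑ) ^ k ∂P ≤ 4 ^ k * ∫⁻ ω, H ω ∂P := by
    have h1 := Finset.sum_le_sum fun (σ : Fin m → Bool) (_ : σ ∈ Finset.univ) =>
      lintegral_enorm_sum_centered_pow_le W hWm hWint hind hk σ
    simp only [hZsum] at h1
    rw [Finset.sum_const, ← Finset.mul_sum, ← lintegral_finsetSum] at h1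
    · simp only [Finset.card_univ, Fintype.card_fun, Fintype.card_bool, Fintype.card_fin,
        nsmul_eq_mul, Nat.cast_pow, Nat.cast_ofNat] at h1
      refine h1.trans (le_of_eq ?_)
      congr 1
      refine lintegral_congr fun ω => ?_
      simp only [hH]
      rw [ENNReal.ofReal_sum_of_nonneg fun σ _ => by positivity]
      refine Finset.sum_congr rfl fun σ _ => ?_
      rw [ENNReal.ofReal_pow (norm_nonneg _), ofReal_norm]
      congr 2
      ext i
      simp [hW, hT]
    · intro σ _
      have : Measurable fun ω => ∑ j, boolSign (σ j) • W j ω :=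
        Finset.measurable_sum _ fun j _ => (hWm j).const_smul (boolSign (σ j))
      exact this.enorm.pow_const k
  -- A measurable substitute for the operator norm, which it never exceeds: only the values at the
  -- finitely many points enter the chaining bound.
  set V : Ω → ℝ := fun ω => (Real.sqrt s)⁻¹ * ‖fun i => T ω (t i)‖ with hV
  have hTt : ∀ ω, ‖fun i => T ω (t i)‖ = ‖fun i j => ‖v j ω (t i)‖‖ := by
    intro ω
    simp only [hT, Pi.norm_def, Pi.nnnorm_def, ContinuousLinearMap.coe_pi', nnnorm_norm]
  have hVm : Measurable V := by
    have : Measurable fun ω => (fun i j => ‖v j ω (t i)‖ : ι → Fin m → ℝ) :=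
      measurable_pi_lambda _ fun i => measurable_pi_lambda _ fun j => hmeas j i
    simp only [hV, hTt]
    exact this.norm.const_mul _
  have hV0 : ∀ ω, 0 ≤ V ω := fun ω => by positivity
  have hVT : ∀ ω, ENNReal.ofReal (V ω) ≤ ‖T ω‖ₑ := by
    intro ω
    rw [← ofReal_norm]
    refine ENNReal.ofReal_le_ofReal ?_
    simp only [hV]
    rw [inv_mul_le_iff₀ hs', pi_norm_le_iff_of_nonneg (by positivity)]
    intro i
    rw [mul_comm]
    exact (T ω).le_opNorm_of_le (ht i)
  set N : Ω → ℝ≥0∞ := fun ω => ENNReal.ofReal (Real.sqrt k * (V ω + τ)) with hN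
  set c₀ : ℝ := 720 * Real.sqrt s * Real.sqrt m with hc₀
  have hc₀' : 0 < c₀ := by positivity
  -- The random radius is ρ = √(m(1 + ‖Z‖)), since ∑ ‖v_j(t_i)‖² = m(μ_i + Z_i) and `μ i ≤ 1`. The
  -- deviation thereby appears on both sides of the estimate.
  set R : Ω → ℝ≥0∞ := fun ω => ENNReal.ofReal c₀ * (1 + ‖Z ω‖ₑ) ^ (1 / 2 : ℝ) with hR
  have hRm : Measurable R := by
    have := hZm.enorm
    simp only [hR]
    fun_prop
  have hReq : ∀ ω, R ω = ENNReal.ofReal (720 * Real.sqrt s * Real.sqrt (m * (1 + ‖Z ω‖))) := by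
    intro ω
    have h1 : (1 : ℝ≥0∞) + ‖Z ω‖ₑ = ENNReal.ofReal (1 + ‖Z ω‖) := by
      rw [ENNReal.ofReal_add (by norm_num) (norm_nonneg _), ofReal_norm,
        ENNReal.ofReal_one]
    simp only [hR]
    rw [Real.sqrt_mul hm'.le, ← mul_assoc, ENNReal.ofReal_mul hc₀'.le, Real.sqrt_eq_rpow (1 + _),
      ← ENNReal.ofReal_rpow_of_nonneg (by positivity) (by norm_num), ← h1]
  have hNm : Measurable N := by
    simp only [hN]
    exact ENNReal.measurable_ofReal.comp ((hVm.add_const _).const_mul _)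
  have hptw : ∀ ω, H ω / 2 ^ m ≤ (R ω * (entropySum (T ω) + N ω)) ^ k := by
    intro ω
    refine ENNReal.div_le_of_le_mul' ?_
    rw [hReq]
    have hρ : 0 < Real.sqrt (m * (1 + ‖Z ω‖)) := Real.sqrt_pos.2 (by positivity)
    refine rademacher_operator_moment_le (T ω) t hs ht hρ (hV0 ω) hτ (fun i => ?_) (fun i => ?_) hk
    · rw [Real.sq_sqrt (by positivity)]
      have h1 : Z ω i ≤ ‖Z ω‖ := (le_abs_self _).trans (norm_le_pi_norm (Z ω) i)
      rw [hZ] at h1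
      have h2 : 1 / (m : ℝ) * ∑ j, ‖v j ω (t i)‖ ^ 2 ≤ 1 + ‖Z ω‖ := by
        rw [hZ]; linarith [hμ i]
      rw [one_div, inv_mul_le_iff₀ hm'] at h2
      exact h2
    · simp only [hV]
      rw [mul_inv_cancel_left₀ hs'.ne']
      exact norm_le_pi_norm (fun i => T ω (t i)) i
  obtain ⟨g, hg, hgle, hHg⟩ := exists_measurable_minorant (hHm.div_const _) hRm hNm
    (fun ω => by rw [hReq, ENNReal.ofReal_ne_zero_iff]; positivity)
    (fun ω => by rw [hReq]; exact ENNReal.ofReal_ne_top) (by omega : k ≠ 0) hptw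
  set f : Ω → ℝ≥0∞ := fun ω => 1 + ‖Z ω‖ₑ with hf
  have hfm : Measurable f := hZm.enorm.const_add _
  set z := (∫⁻ ω, ‖Z ω‖ₑ ^ k ∂P) ^ (1 / (k : ℝ)) with hz
  have hk' : (k : ℝ) ≠ 0 := by positivity
  have root : ∀ a : ℝ≥0∞, (a ^ k) ^ (1 / (k : ℝ)) = a := by
    intro a
    rw [← ENNReal.rpow_natCast, ← ENNReal.rpow_mul, mul_one_div_cancel hk', ENNReal.rpow_one]
  have hmain : (ENNReal.ofReal m) ^ k * ∫⁻ ω, ‖Z ω‖ₑ ^ k ∂P ≤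
      (4 * ENNReal.ofReal c₀) ^ k * ∫⁻ ω, (f ω ^ (1 / 2 : ℝ) * (g ω + N ω)) ^ k ∂P := by
    have h2 : (2 : ℝ≥0∞) ^ m ≠ 0 := by positivity
    have h2t : (2 : ℝ≥0∞) ^ m ≠ ⊤ := by finiteness
    have hH2 : ∫⁻ ω, H ω ∂P ≤ 2 ^ m * ∫⁻ ω, (R ω * (g ω + N ω)) ^ k ∂P := by
      rw [← lintegral_const_mul _ (by fun_prop)]
      refine lintegral_mono fun ω => ?_
      rw [← ENNReal.div_le_iff' h2 h2t]
      exact hHg ω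
    have h3 := hsymm.trans (mul_le_mul_right hH2 _)
    rw [mul_left_comm] at h3
    have h4 := (ENNReal.mul_le_mul_iff_right h2 h2t).1 h3
    simp only [mul_pow (ENNReal.ofReal m)] at h4
    rw [lintegral_const_mul _ (by fun_prop)] at h4
    refine h4.trans (le_of_eq ?_)
    rw [mul_pow, mul_assoc, ← lintegral_const_mul (ENNReal.ofReal c₀ ^ k) (by fun_prop)]
    congr 1
    refine lintegral_congr fun ω => ?_
    simp only [hR]
    rw [← mul_pow, mul_assoc]
  have hroot : ENNReal.ofReal m * z ≤ 4 * ENNReal.ofReal c₀ *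
      ((1 + z) ^ (1 / 2 : ℝ) * (evenMoment P g k + evenMoment P N k)) := by
    have h1 := ENNReal.rpow_le_rpow hmain (by positivity : (0 : ℝ) ≤ 1 / k)
    rw [ENNReal.mul_rpow_of_nonneg _ _ (by positivity),
      ENNReal.mul_rpow_of_nonneg _ _ (by positivity), root, root] at h1
    refine h1.trans ?_
    gcongr
    refine (lintegral_sqrt_mul_pow_rpow_le hfm (hg.add hNm) hk).trans ?_
    gcongr
    · refine (lintegral_pow_add_rpow_le measurable_const hZm.enorm hk).trans ?_
      simp [hz]
    · exact evenMoment_add_le hg hNm hk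
  have hNle : evenMoment P N k ≤ ENNReal.ofReal (Real.sqrt k) *
      (evenMoment P (fun ω => ‖T ω‖ₑ) k + ENNReal.ofReal τ) := by
    have hVm' : Measurable fun ω => ENNReal.ofReal (V ω) := ENNReal.measurable_ofReal.comp hVm
    have hNe : N = fun ω => ENNReal.ofReal (Real.sqrt k) *
        (ENNReal.ofReal (V ω) + ENNReal.ofReal τ) := by
      ext ω
      simp only [hN]
      rw [ENNReal.ofReal_mul (Real.sqrt_nonneg _), ENNReal.ofReal_add (hV0 ω) hτ.le]
    rw [hNe, evenMoment_const_mul _ (hVm'.add_const _) hk]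
    gcongr
    refine (evenMoment_add_le hVm' measurable_const hk).trans ?_
    rw [evenMoment_const _ hk]
    gcongr
    exact evenMoment_mono hVT k
  have hmcoef : ENNReal.ofReal m * ENNReal.ofReal (2880 * Real.sqrt s / Real.sqrt m) =
      4 * ENNReal.ofReal c₀ := by
    rw [← ENNReal.ofReal_mul hm'.le, show (4 : ℝ≥0∞) = ENNReal.ofReal 4 by norm_num,
      ← ENNReal.ofReal_mul (by norm_num)]
    congr 1
    rw [hc₀]
    field_simp
    rw [Real.sq_sqrt hm'.le]
    ring
  rw [← ENNReal.mul_le_mul_iff_right (a := ENNReal.ofReal m) (ENNReal.ofReal_pos.2 hm').ne'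
    ENNReal.ofReal_ne_top]
  refine hroot.trans ?_
  rw [← hmcoef, hA]
  calc _ = ENNReal.ofReal m * (ENNReal.ofReal (2880 * Real.sqrt s / Real.sqrt m) *
        (evenMoment P g k + evenMoment P N k) * (1 + z) ^ (1 / 2 : ℝ)) := by ring
    _ ≤ _ := by
      gcongr
      exact evenMoment_mono hgle k

/-- A crude bound without any cancellation; it serves only to show that the moments of the deviation
are finite, so that the self-bounding inequality can be solved. -/
theorem norm_mean_sq_sub_le {𝕜 E F ι : Type*} [RCLike 𝕜] [NormedAddCommGroup E]
    [NormedSpace 𝕜 E] [NormedAddCommGroup F] [NormedSpace 𝕜 F] [Fintype ι] {m : ℕ} (hm : 0 < m)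
    (T : E →L[𝕜] (Fin m → F)) (t : ι → E) {s : ℝ} (hs : 0 < s) (ht : ∀ i, ‖t i‖ ≤ Real.sqrt s)
    (μ : ι → ℝ) :
    ‖fun i => 1 / (m : ℝ) * ∑ j, ‖T (t i) j‖ ^ 2 - μ i‖ ≤ ‖μ‖ + s * ‖T‖ ^ 2 := by
  have hm' : (0 : ℝ) < m := by exact_mod_cast hm
  rw [pi_norm_le_iff_of_nonneg (by positivity)]
  intro i
  have h1 : ‖T (t i)‖ ^ 2 ≤ s * ‖T‖ ^ 2 := by
    calc ‖T (t i)‖ ^ 2 ≤ (‖T‖ * Real.sqrt s) ^ 2 := by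
          gcongr; exact T.le_opNorm_of_le (ht i)
      _ = s * ‖T‖ ^ 2 := by rw [mul_pow, Real.sq_sqrt hs.le, mul_comm]
  have h2 : ∑ j, ‖T (t i) j‖ ^ 2 ≤ m * ‖T (t i)‖ ^ 2 := by
    calc ∑ j, ‖T (t i) j‖ ^ 2 ≤ ∑ _j : Fin m, ‖T (t i)‖ ^ 2 := by
          gcongr with j; exact norm_le_pi_norm _ j
      _ = _ := by simp
  have h3 : 1 / (m : ℝ) * ∑ j, ‖T (t i) j‖ ^ 2 ≤ s * ‖T‖ ^ 2 := by
    rw [one_div, inv_mul_le_iff₀ hm']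
    exact h2.trans (by gcongr)
  have h4 : 0 ≤ 1 / (m : ℝ) * ∑ j, ‖T (t i) j‖ ^ 2 := by positivity
  refine (norm_sub_le _ _).trans ?_
  rw [Real.norm_of_nonneg h4]
  linarith [norm_le_pi_norm μ i]

theorem lintegral_enorm_pow_ne_top_of_le {Ω B G : Type*} [MeasurableSpace Ω] {P : Measure Ω}
    [IsProbabilityMeasure P] [NormedAddCommGroup B] [NormedAddCommGroup G] (Z : Ω → B) (T : Ω → G)
    {a s : ℝ} (ha : 0 ≤ a) (hs : 0 ≤ s) (hZ : ∀ ω, ‖Z ω‖ ≤ a + s * ‖T ω‖ ^ 2) {k : ℕ}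
    (hT : ∫⁻ ω, ‖T ω‖ₑ ^ (2 * k) ∂P ≠ ⊤) : ∫⁻ ω, ‖Z ω‖ₑ ^ k ∂P ≠ ⊤ := by
  have hpt : ∀ ω, ‖Z ω‖ₑ ^ k ≤
      ENNReal.ofReal ((2 * a) ^ k) + ENNReal.ofReal ((2 * s) ^ k) * ‖T ω‖ₑ ^ (2 * k) := by
    intro ω
    rw [← ofReal_norm, ← ofReal_norm, ← ENNReal.ofReal_pow (norm_nonneg _),
      ← ENNReal.ofReal_pow (norm_nonneg _), ← ENNReal.ofReal_mul (by positivity),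
      ← ENNReal.ofReal_add (by positivity) (by positivity)]
    refine ENNReal.ofReal_le_ofReal ?_
    have h0 : 0 ≤ s * ‖T ω‖ ^ 2 := by positivity
    rw [pow_mul, ← mul_pow, mul_assoc]
    calc ‖Z ω‖ ^ k ≤ (a + s * ‖T ω‖ ^ 2) ^ k := by gcongr; exact hZ ω
      _ ≤ (2 * max a (s * ‖T ω‖ ^ 2)) ^ k := by
        gcongr
        linarith [le_max_left a (s * ‖T ω‖ ^ 2), le_max_right a (s * ‖T ω‖ ^ 2)]
      _ ≤ _ := by
        rcases max_cases a (s * ‖T ω‖ ^ 2) with ⟨h, _⟩ | ⟨h, _⟩ <;> rw [h]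
        · linarith [show 0 ≤ (2 * (s * ‖T ω‖ ^ 2)) ^ k by positivity]
        · linarith [show 0 ≤ (2 * a) ^ k by positivity]
  refine ne_top_of_le_ne_top ?_ (lintegral_mono hpt)
  rw [lintegral_add_left measurable_const, lintegral_const, measure_univ, mul_one,
    lintegral_const_mul' _ _ ENNReal.ofReal_ne_top]
  exact ENNReal.add_ne_top.2 ⟨ENNReal.ofReal_ne_top, ENNReal.mul_ne_top ENNReal.ofReal_ne_top hT⟩

/-- Deviation inequality over finitely many points, with some room in the level. -/
theorem measure_deviation_finite_le {𝕜 E F ι Ω : Type*} [RCLike 𝕜] [NormedAddCommGroup E]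
    [NormedSpace 𝕜 E] [NormedAddCommGroup F] [NormedSpace 𝕜 F] [Fintype ι] [MeasurableSpace Ω]
    {P : Measure Ω} [IsProbabilityMeasure P] {m : ℕ} (hm : 0 < m)
    (v : Fin m → Ω → E →L[𝕜] F) (t : ι → E) {s : ℝ} (hs : 0 < s) (ht : ∀ i, ‖t i‖ ≤ Real.sqrt s)
    (hmeas : ∀ j i, Measurable fun ω => ‖v j ω (t i)‖)
    (hint : ∀ j i, Integrable (fun ω => ‖v j ω (t i)‖ ^ 2) P)
    (hind : iIndepFun (fun j ω (i : ι) => ‖v j ω (t i)‖ ^ 2) P)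
    (μ : ι → ℝ) (hμ : ∀ i, μ i ≤ 1) (hmean : ∀ j i, ∫ ω, ‖v j ω (t i)‖ ^ 2 ∂P = μ i)
    {δ ζ : ℝ} (hδ : 0 < δ) (hζ : 0 < ζ) (hζ1 : ζ < 1)
    (hyp : ∀ k : ℕ, 1 ≤ k → ENNReal.ofReal (92160 * Real.sqrt s / Real.sqrt m) *
        max (evenMoment P (fun ω => entropySum (ContinuousLinearMap.pi fun j => v j ω)) k)
          (ENNReal.ofReal (Real.sqrt (Real.log ζ⁻¹)) *
            evenMoment P (fun ω => ‖ContinuousLinearMap.pi fun j => v j ω‖ₑ) k) ≤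
        ENNReal.ofReal δ) :
    P {ω | ∃ i, ENNReal.ofReal (max δ (δ ^ 2) / 2) <
      ENNReal.ofReal |1 / (m : ℝ) * ∑ j, ‖v j ω (t i)‖ ^ 2 - μ i|} ≤ ENNReal.ofReal ζ := by
  have hm' : (0 : ℝ) < m := by exact_mod_cast hm
  have hsm : 0 < Real.sqrt m := Real.sqrt_pos.2 hm'
  have hs' : 0 < Real.sqrt s := Real.sqrt_pos.2 hs
  set L := Real.log ζ⁻¹ with hL
  have hL0 : 0 < L := Real.log_pos ((one_lt_inv₀ hζ).2 hζ1)
  -- Markov's inequality at this order turns a factor 1/e between moment and level into exp(-k) ≤ ζ.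
  set k := ⌈L⌉₊ with hk
  have hk1 : 1 ≤ k := Nat.one_le_ceil_iff.2 hL0
  have hLk : L ≤ k := Nat.le_ceil L
  have hkL : (k : ℝ) ≤ L + 1 := (Nat.ceil_lt_add_one hL0.le).le
  have hk0 : 0 < Real.sqrt k := Real.sqrt_pos.2 (by exact_mod_cast hk1)
  set κ : ℝ := 2880 * Real.sqrt s / Real.sqrt m with hκ
  have hκ0 : 0 < κ := by positivity
  set ℰ := evenMoment P (fun ω => entropySum (ContinuousLinearMap.pi fun j => v j ω)) k with hℰ
  set 𝒩 := evenMoment P (fun ω => ‖ContinuousLinearMap.pi fun j => v j ω‖ₑ) k with h𝒩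
  have h𝒩ℰ : 𝒩 ≤ ℰ := evenMoment_mono (fun ω => enorm_le_entropySum _) k
  have hmax : ENNReal.ofReal κ * max ℰ (ENNReal.ofReal (Real.sqrt L) * 𝒩) ≤
      ENNReal.ofReal (δ / 32) := by
    have h := hyp k hk1
    rw [show 92160 * Real.sqrt s / Real.sqrt m = 32 * κ by rw [hκ]; ring,
      show δ = 32 * (δ / 32) by ring, ENNReal.ofReal_mul (by norm_num), mul_assoc,
      ENNReal.ofReal_mul (p := 32) (by norm_num)] at h
    exact (ENNReal.mul_le_mul_iff_right (by norm_num) ENNReal.ofReal_ne_top).1 h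
  have hκℰ : ENNReal.ofReal κ * ℰ ≤ ENNReal.ofReal (δ / 32) :=
    le_trans (by gcongr; exact le_max_left _ _) hmax
  have hκ𝒩 : ENNReal.ofReal κ * (ENNReal.ofReal (Real.sqrt L) * 𝒩) ≤ ENNReal.ofReal (δ / 32) :=
    le_trans (by gcongr; exact le_max_right _ _) hmax
  have hκe : ENNReal.ofReal κ ≠ 0 := (ENNReal.ofReal_pos.2 hκ0).ne'
  have hℰt : ℰ ≠ ⊤ := by
    intro h
    rw [h, ENNReal.mul_top hκe, top_le_iff] at hκℰ
    exact ENNReal.ofReal_ne_top hκℰ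
  have hTt : ∫⁻ ω, ‖ContinuousLinearMap.pi fun j => v j ω‖ₑ ^ (2 * k) ∂P ≠ ⊤ := by
    intro h
    have h1 : 𝒩 = ⊤ := by
      rw [h𝒩, evenMoment, h]
      exact ENNReal.top_rpow_of_pos (by positivity)
    exact ne_top_of_le_ne_top hℰt h𝒩ℰ h1
  -- Chosen so that the slack contributes exactly δ/32 to `A`.
  set τ : ℝ := δ / (32 * κ * Real.sqrt k) with hτ
  have hτ0 : 0 < τ := by positivity
  set Z : Ω → ι → ℝ := fun ω i => 1 / (m : ℝ) * ∑ j, ‖v j ω (t i)‖ ^ 2 - μ i with hZ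
  have hZm : Measurable Z := measurable_pi_lambda _ fun i =>
    ((Finset.measurable_sum _ fun j _ => (hmeas j i).pow_const 2).const_mul _).sub_const _
  have hmom := deviation_moment_le hm v t hs ht hmeas hint hind μ hμ hmean hk1 hτ0 Z hZ _ rfl
  rw [← hℰ, ← h𝒩, ← hκ] at hmom
  set A := ENNReal.ofReal κ * (ℰ + ENNReal.ofReal (Real.sqrt k) * (𝒩 + ENNReal.ofReal τ)) with hA
  -- Four contributions of at most δ/32. Rounding up to `k` costs √k ≤ √L + 1, and the additional
  -- `𝒩` is absorbed by `𝒩 ≤ ℰ`.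
  have hAle : A ≤ ENNReal.ofReal (δ / 8) := by
    have hsk : Real.sqrt k ≤ Real.sqrt L + 1 := by
      refine Real.sqrt_le_iff.2 ⟨by positivity, ?_⟩
      nlinarith [Real.sq_sqrt hL0.le, Real.sqrt_nonneg L]
    have hsk' : ENNReal.ofReal (Real.sqrt k) ≤ ENNReal.ofReal (Real.sqrt L) + 1 := by
      rw [← ENNReal.ofReal_one, ← ENNReal.ofReal_add (Real.sqrt_nonneg _) zero_le_one]
      exact ENNReal.ofReal_le_ofReal hsk
    have hτe : ENNReal.ofReal κ * (ENNReal.ofReal (Real.sqrt k) * ENNReal.ofReal τ) =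
        ENNReal.ofReal (δ / 32) := by
      rw [← ENNReal.ofReal_mul hk0.le, ← ENNReal.ofReal_mul hκ0.le, hτ]
      congr 1
      field_simp
    calc A = ENNReal.ofReal κ * ℰ + ENNReal.ofReal κ * (ENNReal.ofReal (Real.sqrt k) * 𝒩) +
          ENNReal.ofReal κ * (ENNReal.ofReal (Real.sqrt k) * ENNReal.ofReal τ) := by rw [hA]; ring
      _ ≤ ENNReal.ofReal κ * ℰ + ENNReal.ofReal κ * ((ENNReal.ofReal (Real.sqrt L) + 1) * 𝒩) +
          ENNReal.ofReal κ * (ENNReal.ofReal (Real.sqrt k) * ENNReal.ofReal τ) := by gcongr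
      _ = ENNReal.ofReal κ * ℰ + (ENNReal.ofReal κ * (ENNReal.ofReal (Real.sqrt L) * 𝒩) +
          ENNReal.ofReal κ * 𝒩) + ENNReal.ofReal (δ / 32) := by rw [hτe]; ring
      _ ≤ ENNReal.ofReal (δ / 32) + (ENNReal.ofReal (δ / 32) + ENNReal.ofReal (δ / 32)) +
          ENNReal.ofReal (δ / 32) := by
        gcongr
        exact le_trans (by gcongr) hκℰ
      _ = ENNReal.ofReal (δ / 8) := by
        rw [← ENNReal.ofReal_add (by positivity) (by positivity),
          ← ENNReal.ofReal_add (by positivity) (by positivity),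
          ← ENNReal.ofReal_add (by positivity) (by positivity)]
        congr 1
        ring
  have hZt : ∫⁻ ω, ‖Z ω‖ₑ ^ k ∂P ≠ ⊤ := by
    refine lintegral_enorm_pow_ne_top_of_le Z (fun ω => ContinuousLinearMap.pi fun j => v j ω)
      (norm_nonneg μ) hs.le (fun ω => ?_) hTt
    exact norm_mean_sq_sub_le hm (ContinuousLinearMap.pi fun j => v j ω) t hs ht μ
  have hk' : (k : ℝ) ≠ 0 := by positivity
  have hz := le_add_sq_of_le_mul_sqrt (ENNReal.rpow_ne_top_of_nonneg (by positivity) hZt) hmom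
  set B : ℝ := δ / 8 + (δ / 8) ^ 2 with hB
  have hzB : ∫⁻ ω, ‖Z ω‖ₑ ^ k ∂P ≤ ENNReal.ofReal B ^ k := by
    have h1 : (∫⁻ ω, ‖Z ω‖ₑ ^ k ∂P) ^ (1 / (k : ℝ)) ≤ ENNReal.ofReal B := by
      refine hz.trans ?_
      rw [hB, ENNReal.ofReal_add (by positivity) (by positivity),
        ENNReal.ofReal_pow (by positivity)]
      gcongr
    rwa [one_div, ENNReal.rpow_inv_le_iff (by positivity), ENNReal.rpow_natCast] at h1
  set M : ℝ := max δ (δ ^ 2) / 2 with hM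
  have hM0 : 0 < M := by
    have := le_max_left δ (δ ^ 2)
    rw [hM]; linarith
  -- Both δ and δ² are at most the maximum, so B ≤ (1/8 + 1/64) max(δ, δ²), and 9e/64 < 1/2.
  have hBM : B ≤ Real.exp (-1) * M := by
    rw [Real.exp_neg, inv_mul_eq_div, le_div_iff₀ (Real.exp_pos 1)]
    have he := Real.exp_one_lt_d9
    have h1 := le_max_left δ (δ ^ 2)
    have h2 := le_max_right δ (δ ^ 2)
    have hBle : B ≤ 9 / 64 * max δ (δ ^ 2) := by rw [hB]; linarith
    have hB0 : 0 ≤ B := by positivity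
    calc B * Real.exp 1 ≤ 9 / 64 * max δ (δ ^ 2) * 3 :=
          mul_le_mul hBle (by linarith) (Real.exp_pos 1).le (by linarith)
      _ ≤ M := by rw [hM]; linarith
  have hsub : {ω | ∃ i, ENNReal.ofReal M <
      ENNReal.ofReal |1 / (m : ℝ) * ∑ j, ‖v j ω (t i)‖ ^ 2 - μ i|} ⊆
      {ω | ENNReal.ofReal M ^ k ≤ ‖Z ω‖ₑ ^ k} := by
    rintro ω ⟨i, hi⟩
    have h1 : ENNReal.ofReal |1 / (m : ℝ) * ∑ j, ‖v j ω (t i)‖ ^ 2 - μ i| ≤ ‖Z ω‖ₑ := by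
      rw [← ofReal_norm]
      exact ENNReal.ofReal_le_ofReal (norm_le_pi_norm (Z ω) i)
    exact pow_le_pow_left₀ zero_le (hi.le.trans h1) k
  have hMk0 : ENNReal.ofReal M ^ k ≠ 0 := pow_ne_zero _ (ENNReal.ofReal_pos.2 hM0).ne'
  have hMkt : ENNReal.ofReal M ^ k ≠ ⊤ := ENNReal.pow_ne_top ENNReal.ofReal_ne_top
  refine (measure_mono hsub).trans ((meas_ge_le_lintegral_div
    (hZm.enorm.pow_const k).aemeasurable hMk0 hMkt).trans ?_)
  refine ENNReal.div_le_of_le_mul (hzB.trans ?_)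
  rw [← ENNReal.ofReal_pow (by positivity), ← ENNReal.ofReal_pow hM0.le,
    ← ENNReal.ofReal_mul hζ.le]
  refine ENNReal.ofReal_le_ofReal ?_
  calc B ^ k ≤ (Real.exp (-1) * M) ^ k := pow_le_pow_left₀ (by positivity) hBM k
    _ = Real.exp (-k) * M ^ k := by
      rw [mul_pow, ← Real.exp_nat_mul]
      ring_nf
    _ ≤ ζ * M ^ k := by
      gcongr
      calc Real.exp (-k) ≤ Real.exp (-L) := Real.exp_le_exp.2 (by linarith)
        _ = ζ := by rw [hL, Real.log_inv, neg_neg, Real.exp_log hζ]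

/-! ### Second moments and passage to the whole of `K_s`. -/

theorem HasSecondMoment.integrable_norm_sq {𝕜 H F Ω : Type*} [RCLike 𝕜] [NormedAddCommGroup H]
    [InnerProductSpace 𝕜 H] [NormedSpace ℝ H] [IsScalarTower ℝ 𝕜 H] [CompleteSpace H]
    [NormedAddCommGroup F] [InnerProductSpace 𝕜 F] [MeasurableSpace Ω]
    {K : CentredConvexBody 𝕜 H} {v : Ω → K.X →L[𝕜] F} {P : Measure Ω} {Φ : H →L[𝕜] H}
    (h : HasSecondMoment K v P Φ) (x : K.X) : Integrable (fun ω => ‖v ω x‖ ^ 2) P := by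
  simpa only [inner_self_eq_norm_sq] using (h x x).1.re

theorem HasSecondMoment.integral_norm_sq {𝕜 H F Ω : Type*} [RCLike 𝕜] [NormedAddCommGroup H]
    [InnerProductSpace 𝕜 H] [NormedSpace ℝ H] [IsScalarTower ℝ 𝕜 H] [CompleteSpace H]
    [NormedAddCommGroup F] [InnerProductSpace 𝕜 F] [MeasurableSpace Ω]
    {K : CentredConvexBody 𝕜 H} {v : Ω → K.X →L[𝕜] F} {P : Measure Ω} {Φ : H →L[𝕜] H}
    (h : HasSecondMoment K v P Φ) (x : K.X) :
    ∫ ω, ‖v ω x‖ ^ 2 ∂P = RCLike.re (inner 𝕜 (K.toH x) (Φ (K.toH x))) := by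
  rw [← (h x x).2, ← integral_re (h x x).1]
  simp only [inner_self_eq_norm_sq]

theorem proposition2p4 :
    ∃ c : ℝ, 0 < c ∧
      ∀ (𝕜 : Type*) [RCLike 𝕜] (H : Type*) [NormedAddCommGroup H] [InnerProductSpace 𝕜 H]
        [NormedSpace ℝ H] [IsScalarTower ℝ 𝕜 H] [CompleteSpace H]
        (K : CentredConvexBody 𝕜 H) (s : ℝ) (_ : 0 < s)
        (m d : ℕ) (_ : 0 < m)
        (Ω : Type*) [MeasurableSpace Ω] (P : Measure Ω) [IsProbabilityMeasure P]
        (v : Fin m → Ω → K.X →L[𝕜] EuclideanSpace 𝕜 (Fin d))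
        (_ : ∀ j, IsRandomOperator (v j) P)
        (_ : iIndepFun (fun j ω (x : K.X) => v j ω x) P)
        (Φ : H →L[𝕜] H) (_ : ‖Φ‖ ≤ 1) (_ : ∀ j, HasSecondMoment K (v j) P Φ)
        (δ ζ : ℝ) (_ : 0 < δ) (_ : 0 < ζ) (_ : ζ < 1)
        (_ : ⨆ (k : ℕ) (_ : 1 ≤ k),
            ENNReal.ofReal (c * Real.sqrt s / Real.sqrt m) *
              max (evenMoment P (fun ω => entropySum (ContinuousLinearMap.pi fun j => v j ω)) k)
                (ENNReal.ofReal (Real.sqrt (Real.log ζ⁻¹)) *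
                  evenMoment P (fun ω => ‖ContinuousLinearMap.pi fun j => v j ω‖ₑ) k)
          ≤ ENNReal.ofReal δ),
        P {ω | ENNReal.ofReal (max δ (δ ^ 2)) ≤
            ⨆ x ∈ K.sparseSphere s,
              ENNReal.ofReal |1 / (m : ℝ) * ∑ j, ‖v j ω x‖ ^ 2
                - RCLike.re (inner 𝕜 (K.toH x) (Φ (K.toH x)))|}
          ≤ ENNReal.ofReal ζ := by
  refine ⟨92160, by norm_num, ?_⟩
  intro 𝕜 _ H _ _ _ _ _ K s hs m d hm Ω _ P _ v hv hind Φ hΦ hmom δ ζ hδ hζ hζ1 hyp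
  have hyp' := fun k hk => (iSup₂_le_iff.1 hyp) k hk
  set G : (Fin m → K.X →L[𝕜] EuclideanSpace 𝕜 (Fin d)) → K.X → ℝ≥0∞ := fun V x =>
    ENNReal.ofReal |1 / (m : ℝ) * ∑ j, ‖V j x‖ ^ 2
      - RCLike.re (inner 𝕜 (K.toH x) (Φ (K.toH x)))| with hG
  have hGx : ∀ V, Continuous (G V) := by
    intro V
    refine ENNReal.continuous_ofReal.comp (continuous_abs.comp (Continuous.sub ?_ ?_))
    · exact continuous_const.mul
        (continuous_finsetSum _ fun j _ => ((V j).continuous.norm).pow 2)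
    · exact RCLike.continuous_re.comp
        (K.toH.continuous.inner (Φ.continuous.comp K.toH.continuous))
  have hGV : ∀ x, Continuous fun V => G V x := by
    intro x
    refine ENNReal.continuous_ofReal.comp (continuous_abs.comp (Continuous.sub ?_ continuous_const))
    refine continuous_const.mul (continuous_finsetSum _ fun j _ => Continuous.pow ?_ 2)
    exact ((ContinuousLinearMap.apply 𝕜 (EuclideanSpace 𝕜 (Fin d)) x).continuous.comp
      (continuous_apply j)).norm
  have hsep : TopologicalSpace.SeparableSpace K.X ∨
      ∃ S : Set (Fin m → K.X →L[𝕜] EuclideanSpace 𝕜 (Fin d)),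
        TopologicalSpace.IsSeparable S ∧ ∀ᵐ ω ∂P, (fun j => v j ω) ∈ S := by
    by_cases hX : TopologicalSpace.SeparableSpace K.X
    · exact Or.inl hX
    · exact Or.inr (exists_isSeparable_pi_ae_mem fun j => (hv j).2.resolve_left hX)
  obtain ⟨D, hDA, hDc, hD⟩ := exists_countable_forall_ae_exists_lt (P := P) G hGx hGV
    (fun ω j => v j ω) hsep (K.sparseSphere s) (ENNReal.ofReal (max δ (δ ^ 2) / 2))
  -- The supremum may reach the level without being attained; halving the level makes the inequality
  -- strict, so some point of `K_s`, and then almost surely some point of `D`, exceeds it.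
  have hle : P {ω | ENNReal.ofReal (max δ (δ ^ 2)) ≤
      ⨆ x ∈ K.sparseSphere s, G (fun j => v j ω) x} ≤
      P {ω | ∃ x ∈ D, ENNReal.ofReal (max δ (δ ^ 2) / 2) < G (fun j => v j ω) x} := by
    refine measure_mono_ae ?_
    filter_upwards [hD] with ω hω hmem
    refine hω ?_
    have hpos : 0 < max δ (δ ^ 2) := lt_max_of_lt_left hδ
    have hlt : ENNReal.ofReal (max δ (δ ^ 2) / 2) <
        ⨆ x ∈ K.sparseSphere s, G (fun j => v j ω) x :=
      lt_of_lt_of_le ((ENNReal.ofReal_lt_ofReal_iff hpos).2 (by linarith)) hmem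
    simpa only [lt_iSup_iff, exists_prop] using hlt
  refine hle.trans (measure_exists_mem_le_of_forall_finset P _ hDc fun S hS => ?_)
  have hSA : ∀ x : S, ‖(x : K.X)‖ ≤ Real.sqrt s ∧ ‖K.toH (x : K.X)‖ = 1 := by
    intro x
    obtain ⟨h1, h2⟩ := hDA (hS x.2)
    rw [h2, mul_one] at h1
    exact ⟨h1, h2⟩
  have hfin := measure_deviation_finite_le (P := P) hm v (fun x : S => (x : K.X)) hs
    (fun x => (hSA x).1) (fun j x => ((hv j).1 x).norm)
    (fun j x => (hmom j).integrable_norm_sq x)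
    (hind.comp (fun _ (φ : K.X → EuclideanSpace 𝕜 (Fin d)) (x : S) => ‖φ x‖ ^ 2)
      fun _ => measurable_pi_lambda _ fun x => ((measurable_pi_apply _).norm).pow_const 2)
    (fun x => RCLike.re (inner 𝕜 (K.toH (x : K.X)) (Φ (K.toH (x : K.X)))))
    (fun x => by
      refine (RCLike.re_le_norm _).trans ((norm_inner_le_norm _ _).trans ?_)
      have h := Φ.le_opNorm (K.toH (x : K.X))
      rw [(hSA x).2] at h ⊢
      linarith)
    (fun j x => (hmom j).integral_norm_sq x) hδ hζ hζ1 hyp'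
  refine (measure_mono ?_).trans hfin
  rintro ω ⟨x, hx, hlt⟩
  exact ⟨⟨x, hx⟩, hlt⟩
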